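/- Let $M$ be a nonempty smooth (Hausdorff) manifold of dimension $n>1$, $TM$ its tangent bundle and $\hat TM=TM\setminus\{0\}$ the tangent bundle with the zero section removed. Let $J=\frac{\partial}{\partial y^i}\otimes dx^i$ be the tangent structure and $\mathbb C=y^i\frac{\partial}{\partial y^i}$ the Liouville vector field. A spray is a smooth vector field $S$ on $\hat TM$ with $JS=\mathbb C$ and $[\mathbb C,S]=S$; its geodesics are the smooth regular curves $c$ on open intervals with $c''=S\circ c'$. Two sprays are projectively related if their geodesics coincide up to an orientation preserving reparametrization, and the projective class of $S$ is the set of all sprays projectively related to $S$. A Finsler function is a continuous function $F:TM\to\mathbb R$ that is smooth and positive on $\hat TM$, vanishes on the zero section, is positively $1$-homogeneous on the fibres, and whose metric tensor $g_{ij}=\frac12\frac{\partial^2F^2}{\partial y^i\partial y^j}$ has rank $n$ on $\hat TM$. Its geodesic spray is the spray $S$ with $i_S\,dd_JF^2=-dF^2$ on $\hat TM$, where $d_Jf=df\circ J$. A spray is Finsler metrizable if it is the geodesic spray of some Finsler function. For every spray $S$ on $M$, the projective class of $S$ contains infinitely many sprays that are not Finsler metrizable. Moreover, whenever the projective class of $S$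 contains the geodesic spray $S_0$ of a Finsler function $F$, there are infinitely many $\lambda\in\mathbb R$ for which the spray $S_0-2\lambda F\mathbb C$ belongs to the projective class of $S$ and is not Finsler metrizable. -/

import Mathlib

open Set VectorField
open scoped Manifold ContDiff Topology

noncomputable section

section FinslerGeometry

variable {E : Type*} [NormedAddCommGroup E] [NormedSpace ℝ E]
  {M : Type*} [TopologicalSpace M] [ChartedSpace E M] [IsManifold 𝓘(ℝ, E) ∞ M]

/-- The slashed tangent bundle: the tangent bundle of `M` with the zero section removed. -/
def slashedTangent (E : Type*) [NormedAddCommGroup E] [NormedSpace ℝ E]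
    (M : Type*) [TopologicalSpace M] [ChartedSpace E M] [IsManifold 𝓘(ℝ, E) ∞ M] :
    Set (TangentBundle 𝓘(ℝ, E) M) :=
  {u | u.2 ≠ 0}

/-- The vertical lift `T_p M → T_u (TM)` at a point `u` of the fibre `T_p M`: the derivative at `u`
of the inclusion of the fibre `T_p M` in `TM`. -/
def verticalLift (u : TangentBundle 𝓘(ℝ, E) M) :
    TangentSpace 𝓘(ℝ, E) u.1 →L[ℝ] TangentSpace 𝓘(ℝ, E).tangent u :=
  mfderiv 𝓘(ℝ, E) 𝓘(ℝ, E).tangent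
    (fun w : E => (⟨u.1, w⟩ : TangentBundle 𝓘(ℝ, E) M)) u.2

/-- The tangent structure `J = ∂/∂yⁱ ⊗ dxⁱ` on `TM`: project to `M`, then lift vertically. -/
def tangentStructure (u : TangentBundle 𝓘(ℝ, E) M) :
    TangentSpace 𝓘(ℝ, E).tangent u →L[ℝ] TangentSpace 𝓘(ℝ, E).tangent u :=
  (verticalLift u).comp
    (mfderiv 𝓘(ℝ, E).tangent 𝓘(ℝ, E) (fun v : TangentBundle 𝓘(ℝ, E) M => v.1) u)

/-- The Liouville vector field `ℂ = yⁱ ∂/∂yⁱ` on `TM`. -/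
def liouville (u : TangentBundle 𝓘(ℝ, E) M) : TangentSpace 𝓘(ℝ, E).tangent u :=
  verticalLift u u.2

variable (E M) in
/-- A spray: a smooth vector field `S` on the slashed tangent bundle with `J S = ℂ` and
`[ℂ, S] = S`. A vector field on the slashed tangent bundle is represented by its extension by `0`
to the zero section, so that two sprays are equal exactly when they agree on the slashed tangent
bundle. -/
structure Spray where
  /-- the underlying vector field -/
  toFun : (u : TangentBundle 𝓘(ℝ, E) M) → TangentSpace 𝓘(ℝ, E).tangent u
  smooth : ContMDiffOn 𝓘(ℝ, E).tangent 𝓘(ℝ, E).tangent.tangent ∞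
    (fun u => (⟨u, toFun u⟩ : TangentBundle 𝓘(ℝ, E).tangent (TangentBundle 𝓘(ℝ, E) M)))
    (slashedTangent E M)
  tangentStructure_apply : ∀ u ∈ slashedTangent E M, tangentStructure u (toFun u) = liouville u
  lieBracket_liouville : ∀ u ∈ slashedTangent E M,
    mlieBracket 𝓘(ℝ, E).tangent liouville toFun u = toFun u
  zero_outside : ∀ u ∉ slashedTangent E M, toFun u = 0

/-- The tangent lift `c'` of a curve `c` in `M`. -/
def tangentLift (E : Type*) [NormedAddCommGroup E] [NormedSpace ℝ E]
    {M : Type*} [TopologicalSpace M] [ChartedSpace E M] [IsManifold 𝓘(ℝ, E) ∞ M]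
    (c : ℝ → M) (t : ℝ) : TangentBundle 𝓘(ℝ, E) M :=
  ⟨c t, mfderiv 𝓘(ℝ, ℝ) 𝓘(ℝ, E) c t (1 : ℝ)⟩

/-- `c` is, on the set `s` (in practice an open interval), a geodesic of the spray `S`: a smooth
regular curve such that `c'' = S ∘ c'`, that is, `c'` is an integral curve of `S`. -/
def IsGeodesicOn (S : Spray E M) (c : ℝ → M) (s : Set ℝ) : Prop :=
  ContMDiffOn 𝓘(ℝ, ℝ) 𝓘(ℝ, E) ∞ c s ∧
  (∀ t ∈ s, tangentLift E c t ∈ slashedTangent E M) ∧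
  ∀ t ∈ s, HasMFDerivAt 𝓘(ℝ, ℝ) 𝓘(ℝ, E).tangent (tangentLift E c) t
    ((1 : ℝ →L[ℝ] ℝ).smulRight (S.toFun (tangentLift E c t)))

/-- An open interval of the real line, bounded or not. -/
def IsOpenInterval (s : Set ℝ) : Prop := IsOpen s ∧ s.OrdConnected

/-- `φ` is a smooth orientation preserving change of parameter from `s'` onto `s`. -/
def IsReparametrization (φ : ℝ → ℝ) (s' s : Set ℝ) : Prop :=
  ContDiffOn ℝ ∞ φ s' ∧ (∀ t ∈ s', 0 < deriv φ t) ∧ φ '' s' = s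

/-- Each geodesic of `S` becomes a geodesic of `S'` after an orientation preserving
reparametrization. -/
def GeodesicsReparametrizeTo (S S' : Spray E M) : Prop :=
  ∀ (s : Set ℝ) (c : ℝ → M), IsOpenInterval s → IsGeodesicOn S c s →
    ∃ (s' : Set ℝ) (φ : ℝ → ℝ), IsOpenInterval s' ∧ IsReparametrization φ s' s ∧
      IsGeodesicOn S' (c ∘ φ) s'

/-- Two sprays are projectively related if their geodesics coincide up to an orientation
preserving reparametrization. -/
def ProjectivelyRelated (S S' : Spray E M) : Prop :=
  GeodesicsReparametrizeTo S S' ∧ GeodesicsReparametrizeTo S' S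

/-- The projective class of a spray. -/
def projectiveClass (S : Spray E M) : Set (Spray E M) := {S' | ProjectivelyRelated S S'}

/-- The metric tensor `g_{ij} = ½ ∂²F²/∂yⁱ∂yʲ` of `F` at `u`: half of the second derivative at `u`
of the restriction of `F²` to the fibre of `TM` through `u`. -/
def metricTensor (F : TangentBundle 𝓘(ℝ, E) M → ℝ) (u : TangentBundle 𝓘(ℝ, E) M)
    (v w : TangentSpace 𝓘(ℝ, E) u.1) : ℝ :=
  (1 / 2 : ℝ) * fderiv ℝ (fderiv ℝ (fun y : E => F ⟨u.1, y⟩ ^ 2)) u.2 v w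

/-- Finsler functions. The last clause says that the metric tensor has full rank. -/
structure IsFinslerFunction (F : TangentBundle 𝓘(ℝ, E) M → ℝ) : Prop where
  continuous : Continuous F
  smooth : ContMDiffOn 𝓘(ℝ, E).tangent 𝓘(ℝ, ℝ) ∞ F (slashedTangent E M)
  pos : ∀ u ∈ slashedTangent E M, 0 < F u
  zero : ∀ p : M, F ⟨p, 0⟩ = 0
  homogeneous : ∀ (p : M) (y : TangentSpace 𝓘(ℝ, E) p) (r : ℝ), 0 < r →
    F ⟨p, r • y⟩ = r * F ⟨p, y⟩
  nondegenerate : ∀ u ∈ slashedTangent E M, ∀ v : TangentSpace 𝓘(ℝ, E) u.1,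
    (∀ w : TangentSpace 𝓘(ℝ, E) u.1, metricTensor F u v w = 0) → v = 0

/-- The differential of a real function on `TM`. -/
def differential (f : TangentBundle 𝓘(ℝ, E) M → ℝ) (u : TangentBundle 𝓘(ℝ, E) M) :
    TangentSpace 𝓘(ℝ, E).tangent u →L[ℝ] ℝ :=
  mfderiv 𝓘(ℝ, E).tangent 𝓘(ℝ, ℝ) f u

/-- The semi-basic `1`-form `d_J f = df ∘ J` on `TM`. -/
def dJ (f : TangentBundle 𝓘(ℝ, E) M → ℝ) (u : TangentBundle 𝓘(ℝ, E) M) :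
    TangentSpace 𝓘(ℝ, E).tangent u →L[ℝ] ℝ :=
  (differential f u).comp (tangentStructure u)

/-- The exterior derivative of a `1`-form on `TM`, evaluated on two vector fields:
`dθ(X, Y) = X(θ(Y)) - Y(θ(X)) - θ([X, Y])`. -/
def extDerivOneForm
    (θ : (u : TangentBundle 𝓘(ℝ, E) M) → TangentSpace 𝓘(ℝ, E).tangent u →L[ℝ] ℝ)
    (X Y : (u : TangentBundle 𝓘(ℝ, E) M) → TangentSpace 𝓘(ℝ, E).tangent u)
    (u : TangentBundle 𝓘(ℝ, E) M) : ℝ :=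
  differential (fun v => θ v (Y v)) u (X u) - differential (fun v => θ v (X v)) u (Y u)
    - θ u (mlieBracket 𝓘(ℝ, E).tangent X Y u)

/-- `S` is the geodesic spray of `F`: `i_S d d_J F² = - dF²` on the slashed tangent bundle,
evaluated on all local smooth vector fields `X`. -/
def IsGeodesicSpray (F : TangentBundle 𝓘(ℝ, E) M → ℝ) (S : Spray E M) : Prop :=
  ∀ u ∈ slashedTangent E M,
    ∀ X : (v : TangentBundle 𝓘(ℝ, E) M) → TangentSpace 𝓘(ℝ, E).tangent v,
      ContMDiffAt 𝓘(ℝ, E).tangent 𝓘(ℝ, E).tangent.tangent ∞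
        (fun v => (⟨v, X v⟩ : TangentBundle 𝓘(ℝ, E).tangent (TangentBundle 𝓘(ℝ, E) M))) u →
      extDerivOneForm (dJ (fun v => F v ^ 2)) S.toFun X u
        = - differential (fun v => F v ^ 2) u (X u)

/-- A spray is Finsler metrizable if it is the geodesic spray of some Finsler function. -/
def IsFinslerMetrizable (S : Spray E M) : Prop :=
  ∃ F : TangentBundle 𝓘(ℝ, E) M → ℝ, IsFinslerFunction F ∧ IsGeodesicSpray F S

/-- `S' = S - 2 P ℂ`, the projective deformation of the spray `S` by the function `P`. -/
def IsProjectiveDeformation (S : Spray E M) (P : TangentBundle 𝓘(ℝ, E) M → ℝ)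
    (S' : Spray E M) : Prop :=
  ∀ u ∈ slashedTangent E M, S'.toFun u = S.toFun u - (2 * P u) • liouville u

end FinslerGeometry

end

/-! Let `S₀` be the geodesic spray of `F`, and suppose `S₀ - 2rFℂ` with `r ≠ 0` is the geodesic
spray of another Finsler function `F'`. Put `k = log (F' / F)`, which is `0`-homogeneous on the
fibres. A Finsler function is constant along the horizontal directions of its own spray
(`LocalFinsler.fderiv_horizontal`). Comparing the two horizontal distributions turns this into a
first order system: in the direction horizontal for `S₀` over `a`, `dk = 2r F_y(a) + rF k_y(a)`, and
along the spray `S₀(k) = 2rF`. Cross-differentiating these two equations leaves the algebraic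
condition `k_y ∘ (Φ + r²F² Id) = 0`, where `Φ` is the Jacobi endomorphism of `S₀`
(`fderiv_logRatio_jacobiEndomorphism`).

Fix one nonzero tangent vector. Since `Φ` has finitely many eigenvalues there, `Φ + r²F² Id` is
invertible for infinitely many `r` (`infinite_isUnit_add_sq_smul_one`). For such an `r` it is
invertible nearby too, so `k_y = 0` nearby and the system reduces to `k_x = 2rF_y`. Hence `F_y` does
not change along the fibre, `F_yy = 0`, and the metric tensor `F_y ⊗ F_y + F F_yy` has rank at most
`1 < n`, a contradiction.

Subtracting `2Pℂ` with `P` smooth and fibrewise `1`-homogeneous gives a spray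
(`exists_isProjectiveDeformation`) with the same geodesics up to a change of parameter solving `φ''
= -2P(c' ∘ φ) φ'²`. If the class of `S` contains a metrizable spray, the argument above applies to
it. Otherwise no member of the class is metrizable, and the class is infinite because it contains
the deformations of `S` by the multiples of a nonzero fibrewise linear function. -/

section TangentChart
-- Induced charts of the tangent bundle, and `J`, `ℂ`, `d_J` in them.
variable {E : Type*} [NormedAddCommGroup E] [NormedSpace ℝ E]
  {M : Type*} [TopologicalSpace M] [ChartedSpace E M] [IsManifold 𝓘(ℝ, E) ∞ M]

variable (E) in
/-- The chart of the tangent bundle induced by the preferred chart of `M` at `p`. -/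
noncomputable def tangentChart (p : M) : PartialEquiv (TangentBundle 𝓘(ℝ, E) M) (E × E) :=
  extChartAt 𝓘(ℝ, E).tangent (⟨p, 0⟩ : TangentBundle 𝓘(ℝ, E) M)

variable {p : M} {u : TangentBundle 𝓘(ℝ, E) M} {z : E × E}

theorem mem_tangentChart_source : u ∈ (tangentChart E p).source ↔ u.1 ∈ (chartAt E p).source := by
  rw [tangentChart, extChartAt_source]
  exact TangentBundle.mem_chart_source_iff _ _

theorem mem_tangentChart_target :
    z ∈ (tangentChart E p).target ↔ z.1 ∈ (chartAt E p).target := by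
  rw [tangentChart, extChartAt_target]
  simp only [ModelWithCorners.range_eq_univ, inter_univ]
  exact TangentBundle.mem_chart_target_iff z (⟨p, 0⟩ : TangentBundle 𝓘(ℝ, E) M)

theorem isOpen_tangentChart_source : IsOpen (tangentChart E p).source :=
  isOpen_extChartAt_source _

theorem isOpen_tangentChart_target : IsOpen (tangentChart E p).target :=
  isOpen_extChartAt_target _

theorem tangentChart_symm_apply (hz : z.1 ∈ (chartAt E p).target) :
    (tangentChart E p).symm z
      = ⟨(chartAt E p).symm z.1, mfderiv 𝓘(ℝ, E) 𝓘(ℝ, E) (chartAt E p).symm z.1 z.2⟩ := by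
  exact (tangentMap_chart_symm (I := 𝓘(ℝ, E)) (p := ⟨p, 0⟩) (q := ⟨z.1, z.2⟩) hz).symm

theorem contMDiffOn_tangentChart :
    ContMDiffOn 𝓘(ℝ, E).tangent 𝓘(ℝ, E × E) ∞ (tangentChart E p) (tangentChart E p).source := by
  have := contMDiffOn_extChartAt (I := 𝓘(ℝ, E).tangent)
    (x := (⟨p, 0⟩ : TangentBundle 𝓘(ℝ, E) M)) (n := ∞)
  rwa [← extChartAt_source 𝓘(ℝ, E).tangent] at this

theorem contMDiffOn_tangentChart_symm :
    ContMDiffOn 𝓘(ℝ, E × E) 𝓘(ℝ, E).tangent ∞ (tangentChart E p).symm (tangentChart E p).target :=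
  contMDiffOn_extChartAt_symm (I := 𝓘(ℝ, E).tangent) (⟨p, 0⟩ : TangentBundle 𝓘(ℝ, E) M)


theorem tangentChart_symm_mem_source (hz : z ∈ (tangentChart E p).target) :
    (tangentChart E p).symm z ∈ (tangentChart E p).source :=
  (tangentChart E p).map_target hz

theorem contMDiffAt_tangentChart_symm (hz : z ∈ (tangentChart E p).target) :
    ContMDiffAt 𝓘(ℝ, E × E) 𝓘(ℝ, E).tangent ∞ (tangentChart E p).symm z :=
  contMDiffOn_tangentChart_symm.contMDiffAt (isOpen_tangentChart_target.mem_nhds hz)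

theorem contMDiffAt_tangentChart (hu : u ∈ (tangentChart E p).source) :
    ContMDiffAt 𝓘(ℝ, E).tangent 𝓘(ℝ, E × E) ∞ (tangentChart E p) u :=
  contMDiffOn_tangentChart.contMDiffAt (isOpen_tangentChart_source.mem_nhds hu)

theorem mdifferentiableAt_tangentChart_symm (hz : z ∈ (tangentChart E p).target) :
    MDifferentiableAt 𝓘(ℝ, E × E) 𝓘(ℝ, E).tangent (tangentChart E p).symm z :=
  (contMDiffAt_tangentChart_symm hz).mdifferentiableAt (by simp)

theorem mdifferentiableAt_tangentChart (hu : u ∈ (tangentChart E p).source) :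
    MDifferentiableAt 𝓘(ℝ, E).tangent 𝓘(ℝ, E × E) (tangentChart E p) u :=
  (contMDiffAt_tangentChart hu).mdifferentiableAt (by simp)

variable (p z) in
/-- The coordinate frame of the tangent bundle at `z`: the derivative of the inverse chart. -/
noncomputable def coordFrame :
    E × E →L[ℝ] TangentSpace 𝓘(ℝ, E).tangent ((tangentChart E p).symm z) :=
  mfderiv 𝓘(ℝ, E × E) 𝓘(ℝ, E).tangent (tangentChart E p).symm z

theorem coordFrame_isInvertible (hz : z ∈ (tangentChart E p).target) :
    (coordFrame p z).IsInvertible := by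
  have := isInvertible_mfderivWithin_extChartAt_symm (I := 𝓘(ℝ, E).tangent) hz
  rwa [ModelWithCorners.range_eq_univ, mfderivWithin_univ] at this

/-- The coordinate expression of a vector field on the tangent bundle. -/
noncomputable def coordField (p : M)
    (V : (u : TangentBundle 𝓘(ℝ, E) M) → TangentSpace 𝓘(ℝ, E).tangent u) (z : E × E) : E × E :=
  (coordFrame p z).inverse (V ((tangentChart E p).symm z))

theorem coordFrame_coordField
    (V : (u : TangentBundle 𝓘(ℝ, E) M) → TangentSpace 𝓘(ℝ, E).tangent u)
    (hz : z ∈ (tangentChart E p).target) :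
    coordFrame p z (coordField p V z) = V ((tangentChart E p).symm z) :=
  (coordFrame_isInvertible hz).self_apply_inverse _

theorem coordField_eq_of_coordFrame
    {V : (u : TangentBundle 𝓘(ℝ, E) M) → TangentSpace 𝓘(ℝ, E).tangent u} {v : E × E}
    (hz : z ∈ (tangentChart E p).target) (h : V ((tangentChart E p).symm z) = coordFrame p z v) :
    coordField p V z = v := by
  rw [coordField, h]
  exact (coordFrame_isInvertible hz).inverse_apply_self _

theorem tangentChart_symm_fiber (hz : z.1 ∈ (chartAt E p).target) (w : E) :
    (tangentChart E p).symm (z.1, w) = ⟨((tangentChart E p).symm z).1,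
      mfderiv 𝓘(ℝ, E) 𝓘(ℝ, E) (chartAt E p).symm z.1 w⟩ := by
  rw [tangentChart_symm_apply (z := (z.1, w)) hz, tangentChart_symm_apply hz]

theorem mfderiv_chart_symm_invertible {x : E} (hx : x ∈ (chartAt E p).target) :
    (mfderiv 𝓘(ℝ, E) 𝓘(ℝ, E) (chartAt E p).symm x).IsInvertible := by
  have := isInvertible_mfderivWithin_extChartAt_symm (I := 𝓘(ℝ, E)) (x := p) (y := x)
    (by simpa using hx)
  rw [ModelWithCorners.range_eq_univ, mfderivWithin_univ] at this
  exact this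

theorem mdifferentiableAt_chart_symm {x : E} (hx : x ∈ (chartAt E p).target) :
    MDifferentiableAt 𝓘(ℝ, E) 𝓘(ℝ, E) (chartAt E p).symm x :=
  (mdifferentiable_chart (I := 𝓘(ℝ, E)) p).mdifferentiableAt_symm hx

/-- In the chart centred at `q` the inclusion of the fibre is `w ↦ (const, B w)` with `B` linear. -/
theorem mdifferentiableAt_fiber (q : M) (w : E) :
    MDifferentiableAt 𝓘(ℝ, E) 𝓘(ℝ, E).tangent
      (fun w : E => (⟨q, w⟩ : TangentBundle 𝓘(ℝ, E) M)) w := by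
  have hq : (chartAt E q) q ∈ (chartAt E q).target := mem_chart_target E q
  have hinv := mfderiv_chart_symm_invertible hq
  set A := mfderiv 𝓘(ℝ, E) 𝓘(ℝ, E) (chartAt E q).symm (chartAt E q q) with hA
  let B : E →L[ℝ] E := A.inverse
  have h : (fun w : E => (⟨q, w⟩ : TangentBundle 𝓘(ℝ, E) M))
      = (tangentChart E q).symm ∘ fun w : E => (chartAt E q q, B w) := by
    funext w
    rw [Function.comp_apply, tangentChart_symm_apply hq]
    have h2 : A (B w) = w := hinv.self_apply_inverse w
    simp only [← hA, h2]
    rw [(chartAt E q).left_inv (mem_chart_source E q)]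
  rw [h]
  refine MDifferentiableAt.comp (I' := 𝓘(ℝ, E × E)) w (mdifferentiableAt_tangentChart_symm
    (mem_tangentChart_target.2 hq)) ?_
  exact ((differentiableAt_const _).prodMk B.differentiableAt).mdifferentiableAt

/-- The inverse chart is linear from each coordinate fibre to the fibre of `TM`. Differentiating
that factorization in two ways gives the formula. -/
theorem verticalLift_tangentChart_symm (hz : z ∈ (tangentChart E p).target) (w : E) :
    verticalLift ((tangentChart E p).symm z)
      (mfderiv 𝓘(ℝ, E) 𝓘(ℝ, E) (chartAt E p).symm z.1 w) = coordFrame p z (0, w) := by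
  have hz' := mem_tangentChart_target.1 hz
  let A : E →L[ℝ] E := mfderiv 𝓘(ℝ, E) 𝓘(ℝ, E) (chartAt E p).symm z.1
  have h : (tangentChart E p).symm ∘ (fun w : E => (z.1, w))
      = (fun w : E => (⟨((tangentChart E p).symm z).1, w⟩ : TangentBundle 𝓘(ℝ, E) M)) ∘ A := by
    funext w
    exact tangentChart_symm_fiber hz' w
  have h1 := mfderiv_comp (I := 𝓘(ℝ, E)) (I' := 𝓘(ℝ, E × E)) (I'' := 𝓘(ℝ, E).tangent)
    (f := fun w : E => (z.1, w)) z.2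
    (mdifferentiableAt_tangentChart_symm hz)
    ((differentiableAt_const _).prodMk differentiableAt_id).mdifferentiableAt
  have h2 := mfderiv_comp (I := 𝓘(ℝ, E)) (I' := 𝓘(ℝ, E)) (I'' := 𝓘(ℝ, E).tangent)
    (f := A) z.2 (mdifferentiableAt_fiber ((tangentChart E p).symm z).1 (A z.2))
    A.mdifferentiableAt
  have hsnd : A z.2 = ((tangentChart E p).symm z).2 := by
    have h3 := tangentChart_symm_fiber hz' z.2
    generalize (tangentChart E p).symm z = u at h3
    exact (congrArg (fun u : TangentBundle 𝓘(ℝ, E) M => (u.2 : E)) h3).symm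
  rw [h, h2] at h1
  have h4 := congrArg (fun L : E →L[ℝ] E × E => L w) h1
  have h5 : mfderiv 𝓘(ℝ, E) 𝓘(ℝ, E) A z.2 = A := by
    rw [mfderiv_eq_fderiv]; exact A.fderiv
  have h6 : mfderiv 𝓘(ℝ, E) 𝓘(ℝ, E × E) (fun w : E => (z.1, w)) z.2
      = (0 : E →L[ℝ] E).prod (ContinuousLinearMap.id ℝ E) := by
    rw [mfderiv_eq_fderiv]
    exact ((hasFDerivAt_const _ _).prodMk (hasFDerivAt_id _)).fderiv
  rw [h5, h6, hsnd] at h4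
  exact h4

theorem mfderiv_proj_coordFrame (hz : z ∈ (tangentChart E p).target) (v : E × E) :
    mfderiv 𝓘(ℝ, E).tangent 𝓘(ℝ, E) (fun v : TangentBundle 𝓘(ℝ, E) M => v.1)
      ((tangentChart E p).symm z) (coordFrame p z v)
      = mfderiv 𝓘(ℝ, E) 𝓘(ℝ, E) (chartAt E p).symm z.1 v.1 := by
  have hz' := mem_tangentChart_target.1 hz
  have h : (fun v : TangentBundle 𝓘(ℝ, E) M => v.1) ∘ (tangentChart E p).symm
      =ᶠ[𝓝 z] (chartAt E p).symm ∘ Prod.fst := by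
    filter_upwards [isOpen_tangentChart_target.mem_nhds hz] with y hy
    simp [tangentChart_symm_apply (mem_tangentChart_target.1 hy)]
  have h1 := mfderiv_comp (I := 𝓘(ℝ, E × E)) (I' := 𝓘(ℝ, E).tangent) (I'' := 𝓘(ℝ, E))
    (f := (tangentChart E p).symm) (g := fun v : TangentBundle 𝓘(ℝ, E) M => v.1) z
    ((Bundle.contMDiff_proj (TangentSpace 𝓘(ℝ, E)) (n := 1)).contMDiffAt.mdifferentiableAt
      one_ne_zero)
    (mdifferentiableAt_tangentChart_symm hz)
  have h2 := mfderiv_comp (I := 𝓘(ℝ, E × E)) (I' := 𝓘(ℝ, E)) (I'' := 𝓘(ℝ, E))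
    (f := Prod.fst) (g := (chartAt E p).symm) z (mdifferentiableAt_chart_symm hz')
    differentiableAt_fst.mdifferentiableAt
  rw [h.mfderiv_eq, h2] at h1
  have h4 := congrArg (fun L : E × E →L[ℝ] E => L v) h1
  have h6 : mfderiv 𝓘(ℝ, E × E) 𝓘(ℝ, E) (Prod.fst : E × E → E) z
      = ContinuousLinearMap.fst ℝ E E := by
    rw [mfderiv_eq_fderiv]
    exact hasFDerivAt_fst.fderiv
  rw [h6] at h4
  exact h4.symm

theorem tangentStructure_coordFrame (hz : z ∈ (tangentChart E p).target) (v : E × E) :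
    tangentStructure ((tangentChart E p).symm z) (coordFrame p z v) = coordFrame p z (0, v.1) := by
  rw [tangentStructure, ← verticalLift_tangentChart_symm hz, ← mfderiv_proj_coordFrame hz]
  rfl

theorem liouville_tangentChart_symm (hz : z ∈ (tangentChart E p).target) :
    liouville ((tangentChart E p).symm z) = coordFrame p z (0, z.2) := by
  rw [liouville, ← verticalLift_tangentChart_symm hz]
  congr 1
  rw [tangentChart_symm_apply (mem_tangentChart_target.1 hz)]

theorem differential_coordFrame {f : TangentBundle 𝓘(ℝ, E) M → ℝ}
    (hz : z ∈ (tangentChart E p).target)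
    (hf : MDifferentiableAt 𝓘(ℝ, E).tangent 𝓘(ℝ, ℝ) f ((tangentChart E p).symm z)) (v : E × E) :
    differential f ((tangentChart E p).symm z) (coordFrame p z v)
      = fderiv ℝ (f ∘ (tangentChart E p).symm) z v := by
  rw [← mfderiv_eq_fderiv, mfderiv_comp z hf (mdifferentiableAt_tangentChart_symm hz)]
  rfl

theorem dJ_coordFrame {f : TangentBundle 𝓘(ℝ, E) M → ℝ}
    (hz : z ∈ (tangentChart E p).target)
    (hf : MDifferentiableAt 𝓘(ℝ, E).tangent 𝓘(ℝ, ℝ) f ((tangentChart E p).symm z)) (v : E × E) :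
    dJ f ((tangentChart E p).symm z) (coordFrame p z v)
      = fderiv ℝ (f ∘ (tangentChart E p).symm) z (0, v.1) := by
  rw [← differential_coordFrame hz hf, ← tangentStructure_coordFrame hz]
  rfl

end TangentChart

/-! ### Vector fields, Lie brackets and sprays in coordinates. -/

theorem mlieBracket_eq_lieBracket {G : Type*} [NormedAddCommGroup G] [NormedSpace ℝ G]
    (V W : G → G) : mlieBracket 𝓘(ℝ, G) V W = lieBracket ℝ V W := by
  rw [← lieBracketWithin_univ]
  exact mlieBracketWithin_univ.symm.trans mlieBracketWithin_eq_lieBracketWithin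

section CoordinateExpressions
variable {E : Type*} [NormedAddCommGroup E] [NormedSpace ℝ E]
  {M : Type*} [TopologicalSpace M] [ChartedSpace E M] [IsManifold 𝓘(ℝ, E) ∞ M]
  {p : M} {u : TangentBundle 𝓘(ℝ, E) M} {z : E × E}
  {V W : (u : TangentBundle 𝓘(ℝ, E) M) → TangentSpace 𝓘(ℝ, E).tangent u}

variable (E) in
/-- The coordinate domain of the slashed tangent bundle in the chart at `p`. -/
def slashedDomain (p : M) : Set (E × E) :=
  {z | z.1 ∈ (chartAt E p).target ∧ z.2 ≠ 0}

omit [NormedSpace ℝ E] [IsManifold 𝓘(ℝ, E) ∞ M] in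
theorem isOpen_slashedDomain (p : M) : IsOpen (slashedDomain E p) :=
  ((chartAt E p).open_target.preimage continuous_fst).inter
    (isOpen_compl_singleton.preimage continuous_snd)

theorem mem_target_of_mem_slashedDomain (hz : z ∈ slashedDomain E p) :
    z ∈ (tangentChart E p).target :=
  mem_tangentChart_target.2 hz.1

theorem tangentChart_symm_mem_slashedTangent_iff (hz : z ∈ (tangentChart E p).target) :
    (tangentChart E p).symm z ∈ slashedTangent E M ↔ z.2 ≠ 0 := by
  have hz' := mem_tangentChart_target.1 hz
  rw [tangentChart_symm_apply hz']
  refine not_congr ?_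
  refine ⟨fun h => (mfderiv_chart_symm_invertible hz').injective (h.trans (map_zero _).symm), ?_⟩
  intro h
  rw [h]
  exact map_zero _

theorem tangentChart_symm_mem_slashedTangent (hz : z ∈ slashedDomain E p) :
    (tangentChart E p).symm z ∈ slashedTangent E M :=
  (tangentChart_symm_mem_slashedTangent_iff (mem_target_of_mem_slashedDomain hz)).2 hz.2

theorem tangentChart_mem_slashedDomain (hu : u ∈ slashedTangent E M)
    (hup : u ∈ (tangentChart E p).source) : tangentChart E p u ∈ slashedDomain E p := by
  have ht := (tangentChart E p).map_source hup
  refine ⟨mem_tangentChart_target.1 ht, ?_⟩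
  rw [← tangentChart_symm_mem_slashedTangent_iff ht, (tangentChart E p).left_inv hup]
  exact hu

theorem isOpen_slashedTangent : IsOpen (slashedTangent E M) := by
  rw [isOpen_iff_mem_nhds]
  intro u hu
  have hup : u ∈ (tangentChart E u.1).source := mem_tangentChart_source.2 (mem_chart_source E u.1)
  have h1 := (mdifferentiableAt_tangentChart hup).continuousAt.preimage_mem_nhds
    ((isOpen_slashedDomain u.1).mem_nhds (tangentChart_mem_slashedDomain hu hup))
  filter_upwards [h1, isOpen_tangentChart_source.mem_nhds hup] with v hv hvs
  rw [← (tangentChart E u.1).left_inv hvs]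
  exact tangentChart_symm_mem_slashedTangent hv

theorem mfderiv_tangentChart_coordFrame (hz : z ∈ (tangentChart E p).target) (v : E × E) :
    mfderiv 𝓘(ℝ, E).tangent 𝓘(ℝ, E × E) (tangentChart E p) ((tangentChart E p).symm z)
      (coordFrame p z v) = v := by
  have := mfderiv_extChartAt_comp_mfderivWithin_extChartAt_symm (I := 𝓘(ℝ, E).tangent) hz
  rw [ModelWithCorners.range_eq_univ, mfderivWithin_univ] at this
  exact congrArg (fun L : E × E →L[ℝ] E × E => L v) this

theorem mfderiv_tangentChart_isInvertible (hu : u ∈ (tangentChart E p).source) :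
    (mfderiv 𝓘(ℝ, E).tangent 𝓘(ℝ, E × E) (tangentChart E p) u).IsInvertible :=
  isInvertible_mfderiv_extChartAt (I := 𝓘(ℝ, E).tangent) hu

/-- The vector field on the tangent bundle with a given coordinate expression. -/
noncomputable def ofCoordField (p : M) (W : E × E → E × E) (u : TangentBundle 𝓘(ℝ, E) M) :
    TangentSpace 𝓘(ℝ, E).tangent u :=
  (mfderiv 𝓘(ℝ, E).tangent 𝓘(ℝ, E × E) (tangentChart E p) u).inverse (W (tangentChart E p u))

theorem ofCoordField_tangentChart_symm (hz : z ∈ (tangentChart E p).target) (W : E × E → E × E) :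
    ofCoordField p W ((tangentChart E p).symm z) = coordFrame p z (W z) := by
  rw [ofCoordField, (tangentChart E p).right_inv hz]
  refine ((mfderiv_tangentChart_isInvertible
    (tangentChart_symm_mem_source hz)).inverse_apply_eq).2 ?_
  exact (mfderiv_tangentChart_coordFrame hz _).symm

theorem coordField_ofCoordField (hz : z ∈ (tangentChart E p).target) (W : E × E → E × E) :
    coordField p (ofCoordField p W) z = W z :=
  coordField_eq_of_coordFrame hz (ofCoordField_tangentChart_symm hz W)

/-- By definition the coordinate expression is the pullback of `V` by the inverse chart, so
smoothness, and below the bracket, follow from naturality of pullbacks. -/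
theorem contDiffAt_coordField [CompleteSpace E] (hz : z ∈ (tangentChart E p).target)
    (hV : ContMDiffAt 𝓘(ℝ, E).tangent 𝓘(ℝ, E).tangent.tangent ∞
      (fun u => (⟨u, V u⟩ : TangentBundle 𝓘(ℝ, E).tangent (TangentBundle 𝓘(ℝ, E) M)))
      ((tangentChart E p).symm z)) :
    ContDiffAt ℝ ∞ (coordField p V) z :=
  contMDiffAt_vectorSpace_iff_contDiffAt.1
    (ContMDiffAt.mpullback_vectorField_preimage (n := ∞) hV (contMDiffAt_tangentChart_symm hz)
      (coordFrame_isInvertible hz) (by simp))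

theorem contMDiffAt_ofCoordField [CompleteSpace E] {W : E × E → E × E}
    (hu : u ∈ (tangentChart E p).source) (hW : ContDiffAt ℝ ∞ W (tangentChart E p u)) :
    ContMDiffAt 𝓘(ℝ, E).tangent 𝓘(ℝ, E).tangent.tangent ∞
      (fun u => (⟨u, ofCoordField p W u⟩ :
        TangentBundle 𝓘(ℝ, E).tangent (TangentBundle 𝓘(ℝ, E) M))) u :=
  ContMDiffAt.mpullback_vectorField_preimage (n := ∞) (contMDiffAt_vectorSpace_iff_contDiffAt.2 hW)
    (contMDiffAt_tangentChart hu) (mfderiv_tangentChart_isInvertible hu) (by simp)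

theorem coordField_mlieBracket [CompleteSpace E] (hz : z ∈ (tangentChart E p).target)
    (hV : MDifferentiableAt 𝓘(ℝ, E).tangent 𝓘(ℝ, E).tangent.tangent
      (fun u => (⟨u, V u⟩ : TangentBundle 𝓘(ℝ, E).tangent (TangentBundle 𝓘(ℝ, E) M)))
      ((tangentChart E p).symm z))
    (hW : MDifferentiableAt 𝓘(ℝ, E).tangent 𝓘(ℝ, E).tangent.tangent
      (fun u => (⟨u, W u⟩ : TangentBundle 𝓘(ℝ, E).tangent (TangentBundle 𝓘(ℝ, E) M)))
      ((tangentChart E p).symm z)) :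
    coordField p (mlieBracket 𝓘(ℝ, E).tangent V W) z
      = lieBracket ℝ (coordField p V) (coordField p W) z := by
  have : IsManifold 𝓘(ℝ, E).tangent (minSmoothness ℝ 2) (TangentBundle 𝓘(ℝ, E) M) := by
    rw [minSmoothness_of_isRCLikeNormedField]
    infer_instance
  have h := mpullback_mlieBracket (n := 2) hV hW ((contMDiffAt_tangentChart_symm hz).of_le
    ENat.LEInfty.out) (by simp)
  exact h.trans (congrFun (mlieBracket_eq_lieBracket (coordField p V) (coordField p W)) z)

theorem mdifferentiableAt_of_coord {f : TangentBundle 𝓘(ℝ, E) M → ℝ}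
    (hz : z ∈ (tangentChart E p).target)
    (hf : DifferentiableAt ℝ (f ∘ (tangentChart E p).symm) z) :
    MDifferentiableAt 𝓘(ℝ, E).tangent 𝓘(ℝ, ℝ) f ((tangentChart E p).symm z) := by
  have hs := tangentChart_symm_mem_source hz
  rw [← (tangentChart E p).right_inv hz] at hf
  have h := hf.mdifferentiableAt.comp _ (mdifferentiableAt_tangentChart hs)
  refine h.congr_of_eventuallyEq ?_
  filter_upwards [isOpen_tangentChart_source.mem_nhds hs] with v hv
  simp [(tangentChart E p).left_inv hv]

theorem contDiffAt_coord {f : TangentBundle 𝓘(ℝ, E) M → ℝ}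
    (hz : z ∈ (tangentChart E p).target)
    (hf : ContMDiffAt 𝓘(ℝ, E).tangent 𝓘(ℝ, ℝ) ∞ f ((tangentChart E p).symm z)) :
    ContDiffAt ℝ ∞ (f ∘ (tangentChart E p).symm) z :=
  (hf.comp z (contMDiffAt_tangentChart_symm hz)).contDiffAt

theorem coordField_liouville (hz : z ∈ (tangentChart E p).target) :
    coordField p liouville z = (0, z.2) :=
  coordField_eq_of_coordFrame hz (liouville_tangentChart_symm hz)

theorem contMDiff_liouville [CompleteSpace E] :
    ContMDiff 𝓘(ℝ, E).tangent 𝓘(ℝ, E).tangent.tangent ∞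
      (fun u => (⟨u, liouville u⟩ :
        TangentBundle 𝓘(ℝ, E).tangent (TangentBundle 𝓘(ℝ, E) M))) := by
  intro u
  have hup : u ∈ (tangentChart E u.1).source := mem_tangentChart_source.2 (mem_chart_source E u.1)
  have h := contMDiffAt_ofCoordField (p := u.1) (W := fun z => (0, z.2)) hup
    (contDiffAt_const.prodMk contDiffAt_snd)
  refine h.congr_of_eventuallyEq ?_
  filter_upwards [isOpen_tangentChart_source.mem_nhds hup] with v hv
  rw [← (tangentChart E u.1).left_inv hv, ofCoordField_tangentChart_symm
    ((tangentChart E u.1).map_source hv), liouville_tangentChart_symm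
    ((tangentChart E u.1).map_source hv)]

namespace Spray

variable (S : Spray E M)

/-- The vertical component of the coordinate expression of a spray. -/
noncomputable def vert (p : M) (z : E × E) : E := (coordField p S.toFun z).2

theorem contMDiffAt (hu : u ∈ slashedTangent E M) :
    ContMDiffAt 𝓘(ℝ, E).tangent 𝓘(ℝ, E).tangent.tangent ∞
      (fun u => (⟨u, S.toFun u⟩ : TangentBundle 𝓘(ℝ, E).tangent (TangentBundle 𝓘(ℝ, E) M))) u :=
  S.smooth.contMDiffAt (isOpen_slashedTangent.mem_nhds hu)

/-- This is the content of `J S = ℂ`: a spray is a second order equation `x' = y`, `y' = H(x, y)`.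
-/
theorem coordField_eq (hz : z ∈ slashedDomain E p) :
    coordField p S.toFun z = (z.2, S.vert p z) := by
  have hz' := mem_target_of_mem_slashedDomain hz
  have h := S.tangentStructure_apply _ (tangentChart_symm_mem_slashedTangent hz)
  rw [← coordFrame_coordField S.toFun hz', tangentStructure_coordFrame hz',
    liouville_tangentChart_symm hz'] at h
  have h1 := (coordFrame_isInvertible hz').injective h
  exact Prod.ext (congrArg Prod.snd h1) rfl

theorem toFun_tangentChart_symm (hz : z ∈ slashedDomain E p) :
    S.toFun ((tangentChart E p).symm z) = coordFrame p z (z.2, S.vert p z) := by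
  rw [← S.coordField_eq hz, coordFrame_coordField _ (mem_target_of_mem_slashedDomain hz)]

theorem contDiffAt_vert [CompleteSpace E] (hz : z ∈ slashedDomain E p) :
    ContDiffAt ℝ ∞ (S.vert p) z :=
  (contDiffAt_coordField (mem_target_of_mem_slashedDomain hz)
    (S.contMDiffAt (tangentChart_symm_mem_slashedTangent hz))).snd

theorem coordField_eventuallyEq (hz : z ∈ slashedDomain E p) :
    coordField p S.toFun =ᶠ[𝓝 z] fun z => (z.2, S.vert p z) := by
  filter_upwards [(isOpen_slashedDomain p).mem_nhds hz] with y hy using S.coordField_eq hy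

/-- The vertical component of `[ℂ, S] = S` reads `dH(0, y) - H = H`, Euler's equation for degree `2`
in `y`. -/
theorem fderiv_vert [CompleteSpace E] (hz : z ∈ slashedDomain E p) :
    fderiv ℝ (S.vert p) z (0, z.2) = (2 : ℝ) • S.vert p z := by
  have hz' := mem_target_of_mem_slashedDomain hz
  have hu := tangentChart_symm_mem_slashedTangent hz
  have h := congrArg (coordFrame p z).inverse (S.lieBracket_liouville _ hu)
  change coordField p (mlieBracket 𝓘(ℝ, E).tangent liouville S.toFun) z
    = coordField p S.toFun z at h
  rw [coordField_mlieBracket hz' (contMDiff_liouville.contMDiffAt.mdifferentiableAt (by simp))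
    ((S.contMDiffAt hu).mdifferentiableAt (by simp))] at h
  have hL : coordField p (liouville (E := E) (M := M)) =ᶠ[𝓝 z] fun z => (0, z.2) := by
    filter_upwards [isOpen_tangentChart_target.mem_nhds hz'] with y hy using coordField_liouville hy
  rw [hL.lieBracket_vectorField_eq (S.coordField_eventuallyEq hz), S.coordField_eq hz,
    lieBracket] at h
  have h1 : HasFDerivAt (fun z : E × E => ((0 : E), z.2))
      ((0 : E × E →L[ℝ] E).prod (ContinuousLinearMap.snd ℝ E E)) z :=
    (hasFDerivAt_const _ _).prodMk hasFDerivAt_snd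
  have h2 : HasFDerivAt (fun z : E × E => (z.2, S.vert p z))
      ((ContinuousLinearMap.snd ℝ E E).prod (fderiv ℝ (S.vert p) z)) z :=
    hasFDerivAt_snd.prodMk ((S.contDiffAt_vert hz).differentiableAt (by simp)).hasFDerivAt
  rw [h1.fderiv, h2.fderiv] at h
  have h3 := congrArg Prod.snd h
  simp only [ContinuousLinearMap.prod_apply, Prod.snd_sub, ContinuousLinearMap.coe_snd'] at h3
  rw [two_smul, ← sub_eq_iff_eq_add]
  exact h3

end Spray

end CoordinateExpressions

/-! ### Local Finsler functions, and the integrability condition for two of them. -/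

section LocalFinsler
variable {E : Type*} [NormedAddCommGroup E] [NormedSpace ℝ E]

theorem fderiv_fderiv_apply {G : Type*} [NormedAddCommGroup G] [NormedSpace ℝ G] {f : G → ℝ}
    {W : G → G} {W' : G →L[ℝ] G} {z : G} (hf : ContDiffAt ℝ ∞ f z) (hW : HasFDerivAt W W' z)
    (v : G) :
    fderiv ℝ (fun z => fderiv ℝ f z (W z)) z v
      = fderiv ℝ (fderiv ℝ f) z v (W z) + fderiv ℝ f z (W' v) := by
  have h1 : DifferentiableAt ℝ (fderiv ℝ f) z :=
    (hf.fderiv_right (m := ∞) (by simp)).differentiableAt (by simp)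
  rw [(h1.hasFDerivAt.clm_apply hW).fderiv]
  simp [add_comm]

theorem fderiv_fderiv_symm {G : Type*} [NormedAddCommGroup G] [NormedSpace ℝ G] {f : G → ℝ}
    {z : G} (hf : ContDiffAt ℝ ∞ f z) (v w : G) :
    fderiv ℝ (fderiv ℝ f) z v w = fderiv ℝ (fderiv ℝ f) z w v :=
  hf.isSymmSndFDerivAt (by
    rw [minSmoothness_of_isRCLikeNormedField]
    exact ENat.LEInfty.out) v w

/-- On an open set `T` of `E × E`, the function `f` is positive and positively `1`-homogeneous in
the fibre variable, and `f ^ 2` satisfies the Euler-Lagrange equations of the vector field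
`(x, y) ↦ (y, H (x, y))`. -/
structure LocalFinsler (T : Set (E × E)) (H : E × E → E) (f : E × E → ℝ) : Prop where
  isOpen : IsOpen T
  contDiffAt_vert : ∀ z ∈ T, ContDiffAt ℝ ∞ H z
  fderiv_vert : ∀ z ∈ T, fderiv ℝ H z (0, z.2) = (2 : ℝ) • H z
  contDiffAt : ∀ z ∈ T, ContDiffAt ℝ ∞ f z
  pos : ∀ z ∈ T, 0 < f z
  euler : ∀ z ∈ T, fderiv ℝ f z (0, z.2) = f z
  eulerLagrange : ∀ z ∈ T, ∀ a : E,
    fderiv ℝ (fderiv ℝ (fun z => f z ^ 2)) z (z.2, H z) (0, a)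
      = fderiv ℝ (fun z => f z ^ 2) z (a, 0)

/-- The connection coefficients of the spray `(x, y) ↦ (y, H (x, y))`, up to sign. -/
noncomputable def connectionCoeff (H : E × E → E) (z : E × E) : E →L[ℝ] E :=
  (1 / 2 : ℝ) • (fderiv ℝ H z).comp (ContinuousLinearMap.inr ℝ E E)

/-- The Jacobi endomorphism of the spray `(x, y) ↦ (y, H (x, y))`. -/
noncomputable def jacobiEndomorphism (H : E × E → E) (z : E × E) : E →L[ℝ] E :=
  fderiv ℝ (connectionCoeff H) z (z.2, H z) - connectionCoeff H z * connectionCoeff H z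
    - (fderiv ℝ H z).comp (ContinuousLinearMap.inl ℝ E E)

theorem fderiv_eq_connectionCoeff (H : E × E → E) (z : E × E) (a : E) :
    fderiv ℝ H z (0, a) = (2 : ℝ) • connectionCoeff H z a := by
  simp [connectionCoeff, smul_smul]

theorem contDiffAt_connectionCoeff {H : E × E → E} {z : E × E} (hH : ContDiffAt ℝ ∞ H z) :
    ContDiffAt ℝ ∞ (connectionCoeff H) z :=
  ((hH.fderiv_right (m := ∞) (by simp)).clm_comp contDiffAt_const).const_smul _

theorem continuousAt_jacobiEndomorphism {H : E × E → E} {z : E × E} (hH : ContDiffAt ℝ ∞ H z) :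
    ContinuousAt (jacobiEndomorphism H) z := by
  have hN := contDiffAt_connectionCoeff hH
  have h1 : ContinuousAt (fderiv ℝ (connectionCoeff H)) z :=
    (hN.fderiv_right (m := ∞) (by simp)).continuousAt
  have h2 : ContinuousAt (fderiv ℝ H) z := (hH.fderiv_right (m := ∞) (by simp)).continuousAt
  exact ((h1.clm_apply (continuousAt_snd.prodMk hH.continuousAt)).sub
    (hN.continuousAt.mul hN.continuousAt)).sub (h2.clm_comp continuousAt_const)

theorem hasFDerivAt_sprayField {H : E × E → E} {z : E × E} (hH : ContDiffAt ℝ ∞ H z) :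
    HasFDerivAt (fun z : E × E => (z.2, H z))
      ((ContinuousLinearMap.snd ℝ E E).prod (fderiv ℝ H z)) z :=
  hasFDerivAt_snd.prodMk (hH.differentiableAt (by simp)).hasFDerivAt

theorem hasFDerivAt_liouvilleField (z : E × E) :
    HasFDerivAt (fun z : E × E => ((0 : E), z.2))
      ((0 : E × E →L[ℝ] E).prod (ContinuousLinearMap.snd ℝ E E)) z :=
  (hasFDerivAt_const _ _).prodMk hasFDerivAt_snd

namespace LocalFinsler

variable {T : Set (E × E)} {H : E × E → E} {f : E × E → ℝ} {z : E × E}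

theorem fderiv_sq (h : LocalFinsler T H f) (hz : z ∈ T) (v : E × E) :
    fderiv ℝ (fun z => f z ^ 2) z v = 2 * f z * fderiv ℝ f z v := by
  rw [fderiv_fun_pow 2 ((h.contDiffAt z hz).differentiableAt (by simp))]
  simp

theorem contDiffAt_sq (h : LocalFinsler T H f) (hz : z ∈ T) :
    ContDiffAt ℝ ∞ (fun z => f z ^ 2) z :=
  (h.contDiffAt z hz).pow 2

theorem eventually (h : LocalFinsler T H f) (hz : z ∈ T) : ∀ᶠ y in 𝓝 z, y ∈ T :=
  h.isOpen.mem_nhds hz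

/-- Conservation of the energy `e = f²`. Differentiating Euler's identity `de(0, y) = 2e` along the
spray and using the Euler-Lagrange equation with `a = y` gives `de(y, 0) + de(0, H) = 2 de(y, H)`.
-/
theorem fderiv_spray_sq (h : LocalFinsler T H f) (hz : z ∈ T) :
    fderiv ℝ (fun z => f z ^ 2) z (z.2, H z) = 0 := by
  have h1 : (fun z => fderiv ℝ (fun z => f z ^ 2) z (0, z.2)) =ᶠ[𝓝 z] fun z => 2 * f z ^ 2 := by
    filter_upwards [h.eventually hz] with y hy
    rw [h.fderiv_sq hy, h.euler y hy]
    ring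
  have h2 := fderiv_fderiv_apply (h.contDiffAt_sq hz) (hasFDerivAt_liouvilleField z) (z.2, H z)
  rw [h1.fderiv_eq, h.eulerLagrange z hz,
    fderiv_const_mul ((h.contDiffAt_sq hz).differentiableAt (by simp))] at h2
  have h3 := map_add (fderiv ℝ (fun z => f z ^ 2) z) (z.2, 0) (0, H z)
  simp only [Prod.mk_add_mk, add_zero, zero_add] at h3
  simp only [smul_apply, smul_eq_mul, ContinuousLinearMap.prod_apply,
    zero_apply, ContinuousLinearMap.coe_snd'] at h2
  linarith

theorem fderiv_spray (h : LocalFinsler T H f) (hz : z ∈ T) : fderiv ℝ f z (z.2, H z) = 0 := by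
  have h1 := h.fderiv_spray_sq hz
  rw [h.fderiv_sq hz] at h1
  have := h.pos z hz
  simpa [this.ne'] using h1

/-- The derivative of a Finsler function in the horizontal directions of its spray vanishes. -/
theorem fderiv_horizontal (h : LocalFinsler T H f) (hz : z ∈ T) (a : E) :
    fderiv ℝ f z (a, connectionCoeff H z a) = 0 := by
  -- Energy conservation is differentiated in the direction `(0, a)`. The spray field contributes
  -- `(a, 2Na)` and Euler-Lagrange contributes `(a, 0)`; together they are twice the horizontal
  -- vector.
  have h1 : (fun z => fderiv ℝ (fun z => f z ^ 2) z (z.2, H z)) =ᶠ[𝓝 z] fun z => 0 := by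
    filter_upwards [h.eventually hz] with y hy using h.fderiv_spray_sq hy
  have h2 := fderiv_fderiv_apply (h.contDiffAt_sq hz)
    (hasFDerivAt_sprayField (h.contDiffAt_vert z hz)) (0, a)
  rw [h1.fderiv_eq, fderiv_fderiv_symm (h.contDiffAt_sq hz), h.eulerLagrange z hz] at h2
  simp only [fderiv_fun_const, Pi.zero_apply, zero_apply,
    ContinuousLinearMap.prod_apply, ContinuousLinearMap.coe_snd', fderiv_eq_connectionCoeff] at h2
  rw [← map_add, h.fderiv_sq hz] at h2
  have h3 : ((a, 0) : E × E) + (a, (2 : ℝ) • connectionCoeff H z a)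
      = (2 : ℝ) • (a, connectionCoeff H z a) := by
    ext <;> simp [two_smul]
  rw [h3, map_smul, smul_eq_mul] at h2
  have := h.pos z hz
  simpa [this.ne'] using h2.symm

/-- By `2`-homogeneity the spray is itself horizontal: it is the horizontal vector over `y`. -/
theorem connectionCoeff_self (h : LocalFinsler T H f) (hz : z ∈ T) :
    connectionCoeff H z z.2 = H z := by
  have := h.fderiv_vert z hz
  rw [fderiv_eq_connectionCoeff] at this
  exact smul_right_injective E (two_ne_zero (α := ℝ)) this

theorem fderiv_fderiv_spray (h : LocalFinsler T H f) (hz : z ∈ T) (a : E) :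
    fderiv ℝ (fderiv ℝ f) z (z.2, H z) (0, a) = - fderiv ℝ f z (0, connectionCoeff H z a) := by
  have h1 : (fun z => fderiv ℝ f z (z.2, H z)) =ᶠ[𝓝 z] fun z => 0 := by
    filter_upwards [h.eventually hz] with y hy using h.fderiv_spray hy
  have h2 := fderiv_fderiv_apply (h.contDiffAt z hz)
    (hasFDerivAt_sprayField (h.contDiffAt_vert z hz)) (0, a)
  rw [h1.fderiv_eq, fderiv_fderiv_symm (h.contDiffAt z hz)] at h2
  simp only [fderiv_fun_const, Pi.zero_apply, zero_apply,
    ContinuousLinearMap.prod_apply, ContinuousLinearMap.coe_snd', fderiv_eq_connectionCoeff] at h2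
  have h3 : ((a, (2 : ℝ) • connectionCoeff H z a) : E × E)
      = (a, connectionCoeff H z a) + (0, connectionCoeff H z a) := by
    ext <;> simp [two_smul]
  rw [h3, map_add, h.fderiv_horizontal hz] at h2
  linarith

section Deformation

variable {H' : E × E → E} {f' : E × E → ℝ} {r : ℝ}

theorem connectionCoeff_deformation (h : LocalFinsler T H f)
    (hH : ∀ z ∈ T, H' z = H z - (2 * (r * f z)) • z.2) (hz : z ∈ T) (a : E) :
    connectionCoeff H' z a = connectionCoeff H z a - (r * fderiv ℝ f z (0, a)) • z.2
      - (r * f z) • a := by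
  have h1 : H' =ᶠ[𝓝 z] fun z => H z - (2 * (r * f z)) • z.2 := by
    filter_upwards [h.eventually hz] with y hy using hH y hy
  have hf := ((h.contDiffAt z hz).differentiableAt (by simp)).hasFDerivAt
  have h2 := ((h.contDiffAt_vert z hz).differentiableAt (by simp)).hasFDerivAt.sub
    (((hf.const_mul r).const_mul 2).smul hasFDerivAt_snd)
  have h3 := h1.fderiv_eq.trans h2.fderiv
  simp only [connectionCoeff, h3, smul_apply, ContinuousLinearMap.comp_apply,
    sub_apply, add_apply, ContinuousLinearMap.inr_apply,
    ContinuousLinearMap.smulRight_apply, ContinuousLinearMap.coe_snd', smul_eq_mul]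
  module

variable (f f') in
/-- The logarithm of the ratio of two Finsler functions. -/
noncomputable def logRatio (z : E × E) : ℝ := Real.log (f' z) - Real.log (f z)

theorem contDiffAt_logRatio (h : LocalFinsler T H f) (h' : LocalFinsler T H' f') (hz : z ∈ T) :
    ContDiffAt ℝ ∞ (logRatio f f') z :=
  ((h'.contDiffAt z hz).log (h'.pos z hz).ne').sub ((h.contDiffAt z hz).log (h.pos z hz).ne')

theorem fderiv_logRatio (h : LocalFinsler T H f) (h' : LocalFinsler T H' f') (hz : z ∈ T)
    (v : E × E) : fderiv ℝ (logRatio f f') z v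
      = (f' z)⁻¹ * fderiv ℝ f' z v - (f z)⁻¹ * fderiv ℝ f z v := by
  have h1 := (((h'.contDiffAt z hz).differentiableAt (by simp)).hasFDerivAt.log
    (h'.pos z hz).ne').sub
    (((h.contDiffAt z hz).differentiableAt (by simp)).hasFDerivAt.log (h.pos z hz).ne')
  have h2 : fderiv ℝ (logRatio f f') z = _ := h1.fderiv
  rw [h2]
  simp

theorem fderiv_logRatio_liouville (h : LocalFinsler T H f) (h' : LocalFinsler T H' f')
    (hz : z ∈ T) : fderiv ℝ (logRatio f f') z (0, z.2) = 0 := by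
  rw [fderiv_logRatio h h' hz, h.euler z hz, h'.euler z hz, inv_mul_cancel₀ (h.pos z hz).ne',
    inv_mul_cancel₀ (h'.pos z hz).ne', sub_self]

/-- `f` is constant in the direction `(a, Na)` and `f'` in the direction `(a, N'a)`. The two differ
by multiples of `(0, y)`, on which `f'` obeys Euler's identity, and of `(0, a)`. -/
theorem fderiv_logRatio_horizontal (h : LocalFinsler T H f) (h' : LocalFinsler T H' f')
    (hH : ∀ z ∈ T, H' z = H z - (2 * (r * f z)) • z.2) (hz : z ∈ T) (a : E) :
    fderiv ℝ (logRatio f f') z (a, connectionCoeff H z a)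
      = 2 * r * fderiv ℝ f z (0, a) + r * f z * fderiv ℝ (logRatio f f') z (0, a) := by
  have h1 := h'.fderiv_horizontal hz a
  have h2 : ((a, connectionCoeff H' z a) : E × E) = (a, connectionCoeff H z a)
      - (r * fderiv ℝ f z (0, a)) • (0, z.2) - (r * f z) • (0, a) := by
    rw [connectionCoeff_deformation h hH hz]
    ext <;> simp
  rw [h2, map_sub, map_sub, map_smul, map_smul, h'.euler z hz, smul_eq_mul, smul_eq_mul] at h1
  have hp := (h.pos z hz).ne'
  have hp' := (h'.pos z hz).ne'
  have h3 : fderiv ℝ f' z (a, connectionCoeff H z a)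
      = r * fderiv ℝ f z (0, a) * f' z + r * f z * fderiv ℝ f' z (0, a) := by linarith
  rw [fderiv_logRatio h h' hz, fderiv_logRatio h h' hz, h.fderiv_horizontal hz, h3]
  field_simp
  ring

theorem fderiv_logRatio_spray (h : LocalFinsler T H f) (h' : LocalFinsler T H' f')
    (hH : ∀ z ∈ T, H' z = H z - (2 * (r * f z)) • z.2) (hz : z ∈ T) :
    fderiv ℝ (logRatio f f') z (z.2, H z) = 2 * r * f z := by
  have h1 := fderiv_logRatio_horizontal h h' hH hz z.2
  rwa [h.connectionCoeff_self hz, h.euler z hz, fderiv_logRatio_liouville h h' hz, mul_zero,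
    add_zero] at h1

/-- The integrability condition: the vertical derivative of the logarithm of the ratio is
annihilated by the Jacobi endomorphism of the deformed spray. -/
theorem fderiv_logRatio_jacobiEndomorphism (h : LocalFinsler T H f) (h' : LocalFinsler T H' f')
    (hH : ∀ z ∈ T, H' z = H z - (2 * (r * f z)) • z.2) (hz : z ∈ T) (a : E) :
    fderiv ℝ (logRatio f f') z (0, jacobiEndomorphism H z a + (r * f z) ^ 2 • a) = 0 := by
  set k := logRatio f f' with hk
  set N := connectionCoeff H with hN
  have hkz : ContDiffAt ℝ ∞ k z := contDiffAt_logRatio h h' hz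
  have hHz := h.contDiffAt_vert z hz
  have hfz := h.contDiffAt z hz
  have hNz := ((contDiffAt_connectionCoeff hHz).differentiableAt (by simp)).hasFDerivAt
  have hfd := (hfz.differentiableAt (by simp)).hasFDerivAt
  have h1 : (fun z => fderiv ℝ k z (z.2, H z)) =ᶠ[𝓝 z] fun z => 2 * r * f z := by
    filter_upwards [h.eventually hz] with y hy using fderiv_logRatio_spray h h' hH hy
  have h2 : (fun z => fderiv ℝ k z (a, N z a)) =ᶠ[𝓝 z]
      fun z => 2 * r * fderiv ℝ f z (0, a) + r * f z * fderiv ℝ k z (0, a) := by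
    filter_upwards [h.eventually hz] with y hy using fderiv_logRatio_horizontal h h' hH hy a
  have e1 := fun v => fderiv_fderiv_apply hkz (hasFDerivAt_sprayField hHz) v
  have e1' : ∀ v, fderiv ℝ (fun z => fderiv ℝ k z (z.2, H z)) z v = 2 * r * fderiv ℝ f z v := by
    intro v
    rw [h1.fderiv_eq, (hfd.const_mul (2 * r)).fderiv]
    simp
  have hW : HasFDerivAt (fun z : E × E => (a, N z a))
      ((0 : E × E →L[ℝ] E).prod ((fderiv ℝ N z).flip a)) z := by
    refine (hasFDerivAt_const _ _).prodMk ?_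
    have := hNz.clm_apply (hasFDerivAt_const a z)
    convert this using 1
    ext v <;> simp [hN]
  have e2 := fderiv_fderiv_apply hkz hW (z.2, H z)
  have hk2 : DifferentiableAt ℝ (fun z => fderiv ℝ k z ((0 : E), a)) z :=
    (((hkz.fderiv_right (m := ∞) (by simp)).clm_apply contDiffAt_const).differentiableAt
      (by simp))
  have hf2 : DifferentiableAt ℝ (fun z => fderiv ℝ f z ((0 : E), a)) z :=
    (((hfz.fderiv_right (m := ∞) (by simp)).clm_apply contDiffAt_const).differentiableAt
      (by simp))
  have e2' := congrArg (fun L : E × E →L[ℝ] ℝ => L (z.2, H z)) (h2.fderiv_eq.trans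
    ((hf2.hasFDerivAt.const_mul (2 * r)).add
      ((hfd.const_mul r).mul hk2.hasFDerivAt)).fderiv)
  simp only [add_apply, smul_apply, smul_eq_mul,
    h.fderiv_spray hz] at e2'
  have c1 := fderiv_fderiv_apply hkz (hasFDerivAt_const ((0 : E), a) z) (z.2, H z)
  have c2 := fderiv_fderiv_apply hfz (hasFDerivAt_const ((0 : E), a) z) (z.2, H z)
  simp only [zero_apply, map_zero, add_zero] at c1 c2
  rw [c1, c2, h.fderiv_fderiv_spray hz, e2] at e2'
  -- `b1` and `b2` differentiate `dk(S) = 2rf` vertically and horizontally, while `e2'`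
  -- differentiates the horizontal equation along `S`.
  have b1 := (e1 (0, a)).symm.trans (e1' (0, a))
  have b2 := (e1 (a, N z a)).symm.trans (e1' (a, N z a))
  rw [h.fderiv_horizontal hz] at b2
  rw [fderiv_fderiv_symm hkz] at b1 b2
  have g1 := fderiv_logRatio_horizontal h h' hH hz a
  have g2 := fderiv_logRatio_horizontal h h' hH hz (N z a)
  have hsplit : fderiv ℝ H z (a, N z a) = fderiv ℝ H z (a, 0) + (2 : ℝ) • N z (N z a) := by
    rw [← fderiv_eq_connectionCoeff, ← map_add]
    simp
  have add_vert : ∀ v b c : E, fderiv ℝ k z (v, b + c)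
      = fderiv ℝ k z (v, b) + fderiv ℝ k z (0, c) := by
    intro v b c
    rw [← map_add]
    simp
  have smul_vert : ∀ (s : ℝ) (c : E), fderiv ℝ k z (0, s • c) = s * fderiv ℝ k z (0, c) := by
    intro s c
    rw [← smul_eq_mul, ← map_smul]
    simp
  have split_vert : ∀ v b : E, fderiv ℝ k z (v, b)
      = fderiv ℝ k z (v, 0) + fderiv ℝ k z (0, b) := by
    intro v b
    rw [← map_add]
    simp
  have goal_eq : jacobiEndomorphism H z a + (r * f z) ^ 2 • a
      = (fderiv ℝ N z (z.2, H z)) a + ((-1 : ℝ) • N z (N z a) + ((-1 : ℝ) • fderiv ℝ H z (a, 0)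
        + (r * f z) ^ 2 • a)) := by
    simp only [jacobiEndomorphism, ← hN, sub_apply,
      mul_apply_eq_comp, ContinuousLinearMap.comp_apply, ContinuousLinearMap.inl_apply]
    module
  rw [goal_eq, add_vert, add_vert, add_vert, smul_vert, smul_vert, smul_vert]
  simp only [ContinuousLinearMap.prod_apply, ContinuousLinearMap.coe_snd',
    zero_apply, ContinuousLinearMap.flip_apply, hsplit,
    fderiv_eq_connectionCoeff, ← hN] at b1 b2 e2'
  rw [add_vert, smul_vert] at b2
  rw [split_vert, smul_vert] at b1
  rw [split_vert] at g1 g2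
  rw [split_vert (N z a)] at b2
  rw [← hk] at g1 g2
  -- By symmetry of second derivatives, the term in `S` and `(a, Na)` cancels between `e2'` and
  -- `b2`, and the term in `S` and `(0, a)` between `e2'` and `b1`. The horizontal equations `g1`,
  -- `g2` remove the remaining derivatives of `k` in base directions.
  linear_combination e2' - b2 + g2 + r * f z * (b1 - g1)

end Deformation

end LocalFinsler

end LocalFinsler

/-! ### The obstruction: invertibility of `Φ + r²F² Id`. -/

section Obstruction
variable {E : Type*} [NormedAddCommGroup E] [NormedSpace ℝ E]

namespace LocalFinsler

variable {T : Set (E × E)} {H H' : E × E → E} {f f' : E × E → ℝ} {z : E × E} {r : ℝ}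

/-- Where the Jacobi endomorphism of the deformed spray is invertible, the Hessian of the Finsler
function in the fibre variable vanishes. -/
theorem fderiv_fderiv_vertical_eq_zero [CompleteSpace E]
    (h : LocalFinsler T H f) (h' : LocalFinsler T H' f')
    (hH : ∀ z ∈ T, H' z = H z - (2 * (r * f z)) • z.2) (hr : r ≠ 0) (hz : z ∈ T)
    (hunit : IsUnit (jacobiEndomorphism H z + (r * f z) ^ 2 • (1 : E →L[ℝ] E))) (a w : E) :
    fderiv ℝ (fderiv ℝ f) z (0, w) (0, a) = 0 := by
  set k := logRatio f f' with hk
  have hcont : ContinuousAt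
      (fun z => jacobiEndomorphism H z + (r * f z) ^ 2 • (1 : E →L[ℝ] E)) z :=
    (continuousAt_jacobiEndomorphism (h.contDiffAt_vert z hz)).add
      (((continuousAt_const.mul (h.contDiffAt z hz).continuousAt).pow 2).smul continuousAt_const)
  -- Units are open, so the endomorphism is onto at all nearby points. A neighbourhood is needed
  -- because this equation is differentiated again below.
  have hvert : ∀ᶠ y in 𝓝 z, ∀ a, fderiv ℝ k y (0, a) = 0 := by
    filter_upwards [h.eventually hz, hcont.eventually (Units.isOpen.mem_nhds hunit)] with y hy hu a
    obtain ⟨b, rfl⟩ : ∃ b, (jacobiEndomorphism H y + (r * f y) ^ 2 • (1 : E →L[ℝ] E)) b = a := by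
      obtain ⟨u, hu⟩ := hu
      refine ⟨(↑u⁻¹ : E →L[ℝ] E) a, ?_⟩
      rw [← hu, ← mul_apply_eq_comp, Units.mul_inv]
      rfl
    exact fderiv_logRatio_jacobiEndomorphism h h' hH hy b
  have hhor : (fun y => fderiv ℝ k y (a, 0)) =ᶠ[𝓝 z] fun y => 2 * r * fderiv ℝ f y (0, a) := by
    filter_upwards [h.eventually hz, hvert] with y hy hv
    have h1 := fderiv_logRatio_horizontal h h' hH hy a
    have h2 : ((a, connectionCoeff H y a) : E × E) = (a, 0) + (0, connectionCoeff H y a) := by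
      simp
    rwa [h2, map_add, hv, hv, mul_zero, add_zero, add_zero] at h1
  have hkz : ContDiffAt ℝ ∞ k z := contDiffAt_logRatio h h' hz
  have hfz := h.contDiffAt z hz
  have hf2 : DifferentiableAt ℝ (fun z => fderiv ℝ f z ((0 : E), a)) z :=
    ((hfz.fderiv_right (m := ∞) (by simp)).clm_apply contDiffAt_const).differentiableAt (by simp)
  -- The mixed second derivative of `k` in `(a, 0)` and `(0, w)` is computed twice: it is `0` since
  -- `k_y = 0`, and `2r f_yy(w, a)` since `k_x = 2r f_y`.
  have c0 := fderiv_fderiv_apply hkz (hasFDerivAt_const ((0 : E), w) z) (a, 0)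
  have c1 := fderiv_fderiv_apply hkz (hasFDerivAt_const (a, (0 : E)) z) (0, w)
  have c2 := fderiv_fderiv_apply hfz (hasFDerivAt_const ((0 : E), a) z) (0, w)
  have hvert' : (fun y => fderiv ℝ k y (0, w)) =ᶠ[𝓝 z] fun _ => 0 :=
    hvert.mono fun y hy => hy w
  rw [hvert'.fderiv_eq] at c0
  rw [hhor.fderiv_eq, fderiv_const_mul hf2, smul_apply, c2, fderiv_fderiv_symm hkz] at c1
  simp only [fderiv_fun_const, Pi.zero_apply, zero_apply, map_zero, add_zero] at c0 c1
  rw [← c0] at c1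
  simpa [hr] using c1

end LocalFinsler

/-- Invertibility fails only when `-(rc)²` is an eigenvalue of `A`. There are finitely many
eigenvalues, and each excludes at most one positive `r`. -/
theorem infinite_isUnit_add_sq_smul_one [FiniteDimensional ℝ E] (A : E →L[ℝ] E) {c : ℝ}
    (hc : 0 < c) : {r : ℝ | r ≠ 0 ∧ IsUnit (A + (r * c) ^ 2 • (1 : E →L[ℝ] E))}.Infinite := by
  have hfin : {μ : ℝ | Module.End.HasEigenvalue (A : E →ₗ[ℝ] E) μ}.Finite :=
    Module.End.finite_hasEigenvalue _
  have hinj : Set.InjOn (fun r : ℝ => -(r * c) ^ 2)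
      ((fun r : ℝ => -(r * c) ^ 2) ⁻¹' {μ | Module.End.HasEigenvalue (A : E →ₗ[ℝ] E) μ}
        ∩ Ioi 0) := by
    intro r hr s hs hrs
    have h1 : (r * c) ^ 2 = (s * c) ^ 2 := neg_injective hrs
    have h2 := (sq_eq_sq₀ (mul_pos hr.2 hc).le (mul_pos hs.2 hc).le).1 h1
    exact mul_right_cancel₀ hc.ne' h2
  have hbad := Set.Finite.of_finite_image (hfin.subset (by
    rintro _ ⟨r, hr, rfl⟩
    exact hr.1)) hinj
  refine ((Ioi_infinite (0 : ℝ)).sdiff hbad).mono ?_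
  rintro r ⟨hr, hr'⟩
  refine ⟨ne_of_gt hr, ?_⟩
  have hinj : Function.Injective (A + (r * c) ^ 2 • (1 : E →L[ℝ] E)) := by
    rw [injective_iff_map_eq_zero]
    intro v hv
    by_contra hv0
    refine hr' ⟨Module.End.hasEigenvalue_of_hasEigenvector (x := v)
      ⟨Module.End.mem_eigenspace_iff.2 ?_, hv0⟩, hr⟩
    have h1 : A v + (r * c) ^ 2 • v = 0 := hv
    rw [neg_smul]
    exact eq_neg_of_add_eq_zero_left h1
  exact ContinuousLinearMap.isUnit_iff_bijective.2
    ⟨hinj, LinearMap.injective_iff_surjective.1 hinj⟩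

/-- The product rule behind `g = F_y ⊗ F_y + F F_yy`: without the Hessian term, the metric tensor
has rank at most one. -/
theorem fderiv_fderiv_sq_fiber {f : E × E → ℝ} {x y : E}
    (hf : ∀ᶠ z in 𝓝 (x, y), ContDiffAt ℝ ∞ f z) (v w : E) :
    fderiv ℝ (fderiv ℝ fun y => f (x, y) ^ 2) y v w
      = 2 * fderiv ℝ f (x, y) (0, v) * fderiv ℝ f (x, y) (0, w)
        + 2 * f (x, y) * fderiv ℝ (fderiv ℝ f) (x, y) (0, v) (0, w) := by
  have hι : ∀ y : E, HasFDerivAt (fun y : E => (x, y)) (ContinuousLinearMap.inr ℝ E E) y :=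
    fun y => hasFDerivAt_prodMk_right x y
  have h1 : fderiv ℝ (fun y => f (x, y) ^ 2) =ᶠ[𝓝 y]
      fun y => (2 * f (x, y)) • (fderiv ℝ f (x, y)).comp (ContinuousLinearMap.inr ℝ E E) := by
    filter_upwards [(hι y).continuousAt.eventually hf] with y' hy'
    have h2 := (((hy'.differentiableAt (by simp)).hasFDerivAt.comp y' (hι y')).pow 2).fderiv
    refine h2.trans ?_
    ext v
    simp
  have hfy := hf.self_of_nhds
  have h3 := ((hfy.differentiableAt (by simp)).hasFDerivAt.comp y (hι y)).const_mul 2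
  have h4 := (((hfy.fderiv_right (m := ∞) (by simp)).differentiableAt (by simp)).hasFDerivAt.comp y
    (hι y)).clm_comp (hasFDerivAt_const (ContinuousLinearMap.inr ℝ E E) y)
  rw [h1.fderiv_eq]
  have h5 := (h3.smul h4).fderiv
  refine (congrArg (fun L : E →L[ℝ] E →L[ℝ] ℝ => L v w) h5).trans ?_
  simp
  ring

end Obstruction

/-! ### Finsler functions on the manifold as local Finsler functions. -/

section Metrizability
variable {E : Type*} [NormedAddCommGroup E] [NormedSpace ℝ E]
  {M : Type*} [TopologicalSpace M] [ChartedSpace E M] [IsManifold 𝓘(ℝ, E) ∞ M]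
  {p : M} {u : TangentBundle 𝓘(ℝ, E) M} {z : E × E}
  {F : TangentBundle 𝓘(ℝ, E) M → ℝ} {S S' : Spray E M}

/-- Positive `1`-homogeneity of a function on the tangent bundle along the fibres. -/
def IsFiberHomogeneous (P : TangentBundle 𝓘(ℝ, E) M → ℝ) : Prop :=
  ∀ (p : M) (y : TangentSpace 𝓘(ℝ, E) p) (r : ℝ), 0 < r → P ⟨p, r • y⟩ = r * P ⟨p, y⟩

theorem IsFiberHomogeneous.coord {P : TangentBundle 𝓘(ℝ, E) M → ℝ} (hP : IsFiberHomogeneous P)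
    {x y : E} (hx : x ∈ (chartAt E p).target) {r : ℝ} (hr : 0 < r) :
    P ((tangentChart E p).symm (x, r • y)) = r * P ((tangentChart E p).symm (x, y)) := by
  rw [tangentChart_symm_apply (z := (x, r • y)) hx, tangentChart_symm_apply (z := (x, y)) hx,
    ← hP _ _ r hr]
  congr 2
  exact map_smul _ _ _

theorem fderiv_coord_liouville (hF : IsFiberHomogeneous F) (hz : z ∈ slashedDomain E p)
    (hd : DifferentiableAt ℝ (F ∘ (tangentChart E p).symm) z) :
    fderiv ℝ (F ∘ (tangentChart E p).symm) z (0, z.2) = F ((tangentChart E p).symm z) := by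
  set f := F ∘ (tangentChart E p).symm with hf
  have h1 : ∀ r : ℝ, 0 < r → f (z.1, r • z.2) = r * f z := fun r hr => hF.coord hz.1 hr
  have hc : HasDerivAt (fun r : ℝ => (z.1, r • z.2)) (0, z.2) 1 := by
    refine (hasDerivAt_const _ _).prodMk ?_
    simpa using (hasDerivAt_id (1 : ℝ)).smul_const z.2
  have h2 : HasDerivAt (fun r : ℝ => f (z.1, r • z.2)) (fderiv ℝ f z (0, z.2)) 1 := by
    have hfz : HasFDerivAt f (fderiv ℝ f z) ((fun r : ℝ => (z.1, r • z.2)) 1) := by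
      simpa using hd.hasFDerivAt
    exact hfz.comp_hasDerivAt 1 hc
  have h3 : HasDerivAt (fun r : ℝ => r * f z) (f z) 1 := by
    simpa using (hasDerivAt_id (1 : ℝ)).mul_const (f z)
  have h4 : (fun r : ℝ => f (z.1, r • z.2)) =ᶠ[𝓝 1] fun r => r * f z := by
    filter_upwards [Ioi_mem_nhds (zero_lt_one' ℝ)] with r hr using h1 r hr
  exact h2.unique (h3.congr_of_eventuallyEq h4)

namespace IsFinslerFunction

theorem contMDiffAt (hF : IsFinslerFunction F) (hu : u ∈ slashedTangent E M) :
    ContMDiffAt 𝓘(ℝ, E).tangent 𝓘(ℝ, ℝ) ∞ F u :=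
  hF.smooth.contMDiffAt (isOpen_slashedTangent.mem_nhds hu)

theorem contDiffAt_coord (hF : IsFinslerFunction F) (hz : z ∈ slashedDomain E p) :
    ContDiffAt ℝ ∞ (F ∘ (tangentChart E p).symm) z :=
  _root_.contDiffAt_coord (mem_target_of_mem_slashedDomain hz)
    (hF.contMDiffAt (tangentChart_symm_mem_slashedTangent hz))

theorem fderiv_coord_liouville (hF : IsFinslerFunction F) (hz : z ∈ slashedDomain E p) :
    fderiv ℝ (F ∘ (tangentChart E p).symm) z (0, z.2) = F ((tangentChart E p).symm z) :=
  _root_.fderiv_coord_liouville hF.homogeneous hz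
    ((hF.contDiffAt_coord hz).differentiableAt (by simp))

/-- The equation `i_S dd_J F² = -dF²` is tested on the field `X` with constant coordinates `(a, 0)`.
Here `d_J F²(S) = ℂ(F²) = 2F²`, and `[S, X]` is vertical, hence killed by `d_J F²`. -/
theorem eulerLagrange_coord [CompleteSpace E] (hF : IsFinslerFunction F) (hS : IsGeodesicSpray F S)
    (hz : z ∈ slashedDomain E p) (a : E) :
    fderiv ℝ (fderiv ℝ (fun z => (F ∘ (tangentChart E p).symm) z ^ 2)) z (z.2, S.vert p z) (0, a)
      = fderiv ℝ (fun z => (F ∘ (tangentChart E p).symm) z ^ 2) z (a, 0) := by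
  set e := fun z => (F ∘ (tangentChart E p).symm) z ^ 2 with he
  set G := fun v : TangentBundle 𝓘(ℝ, E) M => F v ^ 2 with hG
  have hGe : G ∘ (tangentChart E p).symm = e := rfl
  have ht := mem_target_of_mem_slashedDomain hz
  have hu := tangentChart_symm_mem_slashedTangent hz
  have hez : ContDiffAt ℝ ∞ e z := (hF.contDiffAt_coord hz).pow 2
  have hGd : ∀ y ∈ slashedDomain E p, MDifferentiableAt 𝓘(ℝ, E).tangent 𝓘(ℝ, ℝ) G
      ((tangentChart E p).symm y) := fun y hy =>
    mdifferentiableAt_of_coord (mem_target_of_mem_slashedDomain hy)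
      (((hF.contDiffAt_coord hy).pow 2).differentiableAt (by simp))
  set X := ofCoordField (M := M) p (fun _ : E × E => (a, (0 : E))) with hX
  have hXsmooth := contMDiffAt_ofCoordField (W := fun _ : E × E => (a, (0 : E)))
    (tangentChart_symm_mem_source ht) contDiffAt_const
  have key := hS _ hu X hXsmooth
  have hT := (isOpen_slashedDomain p).mem_nhds hz
  have hθX : (fun v => dJ G v (X v)) ∘ (tangentChart E p).symm
      =ᶠ[𝓝 z] fun y => fderiv ℝ e y (0, a) := by
    filter_upwards [hT] with y hy
    have hy' := mem_target_of_mem_slashedDomain hy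
    rw [Function.comp_apply, hX, ofCoordField_tangentChart_symm hy', dJ_coordFrame hy' (hGd y hy)]
    rfl
  have hθS : (fun v => dJ G v (S.toFun v)) ∘ (tangentChart E p).symm
      =ᶠ[𝓝 z] fun y => 2 * e y := by
    filter_upwards [hT] with y hy
    have hy' := mem_target_of_mem_slashedDomain hy
    rw [Function.comp_apply, S.toFun_tangentChart_symm hy, dJ_coordFrame hy' (hGd y hy), hGe, he]
    rw [fderiv_fun_pow 2 ((hF.contDiffAt_coord hy).differentiableAt (by simp))]
    simp only [smul_apply, hF.fderiv_coord_liouville hy]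
    simp
    ring
  have hdX : DifferentiableAt ℝ (fun y => fderiv ℝ e y ((0 : E), a)) z :=
    ((hez.fderiv_right (m := ∞) (by simp)).clm_apply contDiffAt_const).differentiableAt (by simp)
  have hed := hez.differentiableAt (n := ∞) (by simp)
  have hbr : coordField p (mlieBracket 𝓘(ℝ, E).tangent S.toFun X) z
      = - (0, fderiv ℝ (S.vert p) z (a, 0)) := by
    rw [coordField_mlieBracket ht ((S.contMDiffAt hu).mdifferentiableAt (by simp))
      (hXsmooth.mdifferentiableAt (by simp))]
    have hL : coordField p X =ᶠ[𝓝 z] fun _ => (a, 0) := by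
      filter_upwards [isOpen_tangentChart_target.mem_nhds ht] with y hy
        using coordField_ofCoordField hy _
    rw [(S.coordField_eventuallyEq hz).lieBracket_vectorField_eq hL, lieBracket,
      (hasFDerivAt_sprayField (S.contDiffAt_vert hz)).fderiv]
    simp
  have hθbr : dJ G ((tangentChart E p).symm z) (mlieBracket 𝓘(ℝ, E).tangent S.toFun X
      ((tangentChart E p).symm z)) = 0 := by
    rw [← coordFrame_coordField (mlieBracket 𝓘(ℝ, E).tangent S.toFun X) ht,
      dJ_coordFrame ht (hGd z hz), hbr]
    have : ((0 : E), (-((0 : E), fderiv ℝ (S.vert p) z (a, 0))).1) = 0 := by simp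
    rw [this, map_zero]
  have c := fderiv_fderiv_apply hez (hasFDerivAt_const ((0 : E), a) z) (z.2, S.vert p z)
  rw [extDerivOneForm, hθbr, hX, ofCoordField_tangentChart_symm ht, ← hX,
    S.toFun_tangentChart_symm hz,
    differential_coordFrame ht (mdifferentiableAt_of_coord ht
      (hdX.congr_of_eventuallyEq hθX)),
    differential_coordFrame ht (mdifferentiableAt_of_coord ht
      ((hed.const_mul 2).congr_of_eventuallyEq hθS)),
    differential_coordFrame ht (hGd z hz), hθX.fderiv_eq, hθS.fderiv_eq, fderiv_const_mul hed, c,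
    hGe] at key
  simp only [zero_apply, map_zero, add_zero, smul_apply, smul_eq_mul] at key
  linarith

theorem localFinsler [CompleteSpace E] (hF : IsFinslerFunction F) (hS : IsGeodesicSpray F S)
    (p : M) : LocalFinsler (slashedDomain E p) (S.vert p) (F ∘ (tangentChart E p).symm) where
  isOpen := isOpen_slashedDomain p
  contDiffAt_vert _ hz := S.contDiffAt_vert hz
  fderiv_vert _ hz := S.fderiv_vert hz
  contDiffAt _ hz := hF.contDiffAt_coord hz
  pos _ hz := hF.pos _ (tangentChart_symm_mem_slashedTangent hz)
  euler _ hz := hF.fderiv_coord_liouville hz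
  eulerLagrange _ hz a := hF.eulerLagrange_coord hS hz a

end IsFinslerFunction

theorem IsProjectiveDeformation.vert_eq {P : TangentBundle 𝓘(ℝ, E) M → ℝ}
    (h : IsProjectiveDeformation S P S') (hz : z ∈ slashedDomain E p) :
    S'.vert p z = S.vert p z - (2 * P ((tangentChart E p).symm z)) • z.2 := by
  have h1 := h _ (tangentChart_symm_mem_slashedTangent hz)
  have ht := mem_target_of_mem_slashedDomain hz
  rw [S.toFun_tangentChart_symm hz, S'.toFun_tangentChart_symm hz, liouville_tangentChart_symm ht,
    ← map_smul, ← map_sub] at h1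
  simpa using congrArg Prod.snd ((coordFrame_isInvertible ht).injective h1)

theorem tangentChart_symm_chart_self (p : M) (y : E) :
    (tangentChart E p).symm (chartAt E p p, y) = ⟨p, y⟩ := by
  have h := (mfderivWithin_range_extChartAt_symm (I := 𝓘(ℝ, E)) (x := p))
  rw [ModelWithCorners.range_eq_univ, mfderivWithin_univ] at h
  rw [tangentChart_symm_apply (mem_chart_target E p)]
  have h1 : (mfderiv 𝓘(ℝ, E) 𝓘(ℝ, E) (chartAt E p).symm (chartAt E p p) : E →L[ℝ] E)
      = ContinuousLinearMap.id ℝ E := h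
  simp only [h1]
  rw [(chartAt E p).left_inv (mem_chart_source E p)]
  rfl

/-- A projective deformation of the geodesic spray of a Finsler function `F` by a nonzero multiple
`r F` is not Finsler metrizable if its Jacobi endomorphism is invertible at one point. -/
theorem not_isFinslerMetrizable_of_isUnit [FiniteDimensional ℝ E] (hE : 1 < Module.finrank ℝ E)
    (hF : IsFinslerFunction F) (hS : IsGeodesicSpray F S) {r : ℝ} (hr : r ≠ 0)
    (hS' : IsProjectiveDeformation S (fun u => r * F u) S') {p : M} {y : E} (hy : y ≠ 0)
    (hunit : IsUnit (jacobiEndomorphism (S.vert p) (chartAt E p p, y)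
      + (r * F ⟨p, y⟩) ^ 2 • (1 : E →L[ℝ] E))) : ¬ IsFinslerMetrizable S' := by
  have : CompleteSpace E := FiniteDimensional.complete ℝ E
  rintro ⟨F', hF', hFS'⟩
  have hz : (chartAt E p p, y) ∈ slashedDomain E p := ⟨mem_chart_target E p, hy⟩
  set f := F ∘ (tangentChart E p).symm with hf
  have hfp : ∀ y : E, f (chartAt E p p, y) = F ⟨p, y⟩ := fun y => by
    rw [hf, Function.comp_apply, tangentChart_symm_chart_self]
  have hzero := (hF.localFinsler hS p).fderiv_fderiv_vertical_eq_zero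
    (hF'.localFinsler hFS' p) (fun z hz => hS'.vert_eq hz) hr hz
    (by rw [← hfp] at hunit; exact hunit)
  -- Dimension greater than one enters here: the linear form `F_y` has a nonzero kernel vector,
  -- which is then in the kernel of the metric tensor.
  obtain ⟨v, hv, hv0⟩ : ∃ v : E, fderiv ℝ f (chartAt E p p, y) (0, v) = 0 ∧ v ≠ 0 := by
    obtain ⟨v, hv, hv0⟩ := Submodule.exists_mem_ne_zero_of_ne_bot
      (LinearMap.ker_ne_bot_of_finrank_lt (f := (((fderiv ℝ f (chartAt E p p, y)).comp
        (ContinuousLinearMap.inr ℝ E E) : E →L[ℝ] ℝ) : E →ₗ[ℝ] ℝ)) (by simpa using hE))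
    exact ⟨v, hv, hv0⟩
  refine hv0 (hF.nondegenerate ⟨p, y⟩ hy v fun (w : E) => ?_)
  have hmt : metricTensor F ⟨p, y⟩ v w
      = (1 / 2 : ℝ) * fderiv ℝ (fderiv ℝ fun y => f (chartAt E p p, y) ^ 2) y v w := by
    simp only [hfp]
    rfl
  have hsq := fderiv_fderiv_sq_fiber (f := f) (x := chartAt E p p) (y := y) (by
    filter_upwards [(isOpen_slashedDomain p).mem_nhds hz] with z hz
      using hF.contDiffAt_coord hz) v w
  rw [hv, hzero] at hsq
  rw [hmt]
  refine (congrArg _ hsq).trans ?_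
  simp

end Metrizability

/-! ### Projective deformations of sprays are sprays. -/

section ProjectiveDeformation
variable {E : Type*} [NormedAddCommGroup E] [NormedSpace ℝ E]
  {M : Type*} [TopologicalSpace M] [ChartedSpace E M] [IsManifold 𝓘(ℝ, E) ∞ M]
  {p : M} {u : TangentBundle 𝓘(ℝ, E) M} {z : E × E}

theorem liouville_eq_zero (hu : u ∉ slashedTangent E M) : liouville u = 0 := by
  have hu2 : u.2 = 0 := not_not.1 hu
  rw [liouville, hu2, map_zero]

/-- Subtracting a multiple of `ℂ` changes only the vertical component, so `J S' = ℂ` persists. Since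
`P` has degree `1`, `P y` has degree `2`, which gives `[ℂ, S'] = S'`. -/
theorem exists_isProjectiveDeformation [CompleteSpace E] (S : Spray E M)
    {P : TangentBundle 𝓘(ℝ, E) M → ℝ}
    (hP : ContMDiffOn 𝓘(ℝ, E).tangent 𝓘(ℝ, ℝ) ∞ P (slashedTangent E M))
    (hom : IsFiberHomogeneous P) : ∃ S' : Spray E M, IsProjectiveDeformation S P S' := by
  set V : (u : TangentBundle 𝓘(ℝ, E) M) → TangentSpace 𝓘(ℝ, E).tangent u :=
    fun u => S.toFun u - (2 * P u) • liouville u with hV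
  set H' : M → E × E → E :=
    fun p z => S.vert p z - (2 * (P ∘ (tangentChart E p).symm) z) • z.2 with hH'
  have hframe : ∀ p : M, ∀ z ∈ slashedDomain E p,
      V ((tangentChart E p).symm z) = coordFrame p z (z.2, H' p z) := by
    intro p z hz
    have ht := mem_target_of_mem_slashedDomain hz
    simp only [hV, hH']
    rw [S.toFun_tangentChart_symm hz, liouville_tangentChart_symm ht, ← map_smul, ← map_sub]
    simp
  have hcoord : ∀ u ∈ slashedTangent E M, ∃ z ∈ slashedDomain E u.1,
      u = (tangentChart E u.1).symm z ∧ u ∈ (tangentChart E u.1).source ∧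
        tangentChart E u.1 u = z := by
    intro u hu
    have hs : u ∈ (tangentChart E u.1).source :=
      mem_tangentChart_source.2 (mem_chart_source E u.1)
    exact ⟨_, tangentChart_mem_slashedDomain hu hs, ((tangentChart E u.1).left_inv hs).symm, hs,
      rfl⟩
  have hPz : ∀ p : M, ∀ z ∈ slashedDomain E p,
      ContDiffAt ℝ ∞ (P ∘ (tangentChart E p).symm) z := fun p z hz =>
    contDiffAt_coord (mem_target_of_mem_slashedDomain hz) (hP.contMDiffAt
      (isOpen_slashedTangent.mem_nhds (tangentChart_symm_mem_slashedTangent hz)))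
  have hH'z : ∀ p : M, ∀ z ∈ slashedDomain E p, ContDiffAt ℝ ∞ (H' p) z := fun p z hz =>
    (S.contDiffAt_vert hz).sub ((contDiffAt_const.mul (hPz p z hz)).smul contDiffAt_snd)
  have hsmooth : ∀ u ∈ slashedTangent E M,
      ContMDiffAt 𝓘(ℝ, E).tangent 𝓘(ℝ, E).tangent.tangent ∞
        (fun u => (⟨u, V u⟩ : TangentBundle 𝓘(ℝ, E).tangent (TangentBundle 𝓘(ℝ, E) M))) u := by
    intro u hu
    obtain ⟨z, hz, -, hs, huz⟩ := hcoord u hu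
    have h := contMDiffAt_ofCoordField (p := u.1) (W := fun z => (z.2, H' u.1 z)) hs
      (by rw [huz]; exact contDiffAt_snd.prodMk (hH'z u.1 z hz))
    refine h.congr_of_eventuallyEq ?_
    filter_upwards [isOpen_tangentChart_source.mem_nhds hs, isOpen_slashedTangent.mem_nhds hu]
      with v hv hvs
    have hvz := tangentChart_mem_slashedDomain hvs hv
    rw [← (tangentChart E u.1).left_inv hv, ofCoordField_tangentChart_symm
      ((tangentChart E u.1).map_source hv), hframe _ _ hvz]
  refine ⟨⟨V, fun u hu => (hsmooth u hu).contMDiffWithinAt, ?_, ?_, ?_⟩, fun u _ => rfl⟩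
  · intro u hu
    obtain ⟨z, hz, huz, -, -⟩ := hcoord u hu
    have ht := mem_target_of_mem_slashedDomain hz
    rw [huz, hframe _ _ hz, tangentStructure_coordFrame ht, liouville_tangentChart_symm ht]
  · intro u hu
    have hVu := hsmooth u hu
    obtain ⟨z, hz, huz, -, -⟩ := hcoord u hu
    -- The centre of the chart is detached from `u`, so that `u` can be replaced by its coordinates.
    generalize u.1 = p at hz huz
    subst huz
    have ht := mem_target_of_mem_slashedDomain hz
    have hVev : coordField p V =ᶠ[𝓝 z] fun z => (z.2, H' p z) := by
      filter_upwards [(isOpen_slashedDomain p).mem_nhds hz] with y hy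
        using coordField_eq_of_coordFrame (mem_target_of_mem_slashedDomain hy) (hframe p y hy)
    have hLev : coordField p (liouville (E := E) (M := M)) =ᶠ[𝓝 z] fun z => (0, z.2) := by
      filter_upwards [isOpen_tangentChart_target.mem_nhds ht] with y hy
        using coordField_liouville hy
    have hPd := ((hPz p z hz).differentiableAt (by simp)).hasFDerivAt
    have hH'd : fderiv ℝ (H' p) z (0, z.2) = (2 : ℝ) • H' p z := by
      have h2 := ((S.contDiffAt_vert hz).differentiableAt (by simp)).hasFDerivAt.sub
        ((hPd.const_mul 2).smul hasFDerivAt_snd)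
      have h3 : fderiv ℝ (H' p) z = _ := h2.fderiv
      have h4 := fderiv_coord_liouville hom hz hPd.differentiableAt
      rw [h3]
      simp only [sub_apply, add_apply, smul_apply, ContinuousLinearMap.smulRight_apply,
        ContinuousLinearMap.coe_snd', S.fderiv_vert hz, h4, hH', Function.comp_apply, smul_eq_mul]
      module
    have hbr : coordField p (mlieBracket 𝓘(ℝ, E).tangent liouville V) z = (z.2, H' p z) := by
      rw [coordField_mlieBracket ht (contMDiff_liouville.contMDiffAt.mdifferentiableAt (by simp))
        (hVu.mdifferentiableAt (by simp)), hLev.lieBracket_vectorField_eq hVev, lieBracket,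
        (hasFDerivAt_sprayField (hH'z p z hz)).fderiv, (hasFDerivAt_liouvilleField z).fderiv]
      simp only [ContinuousLinearMap.prod_apply, ContinuousLinearMap.coe_snd', hH'd, zero_apply]
      ext
      · simp
      · simp [two_smul]
    rw [← coordFrame_coordField (mlieBracket 𝓘(ℝ, E).tangent liouville V) ht, hbr, hframe p z hz]
  · intro u hu
    simp only [hV, S.zero_outside u hu, liouville_eq_zero hu, smul_zero, sub_zero]

namespace Spray

/-- Euler's equation integrated along a ray: `s⁻² H(x, s y)` has zero derivative on `(0, ∞)`. -/
theorem vert_smul [CompleteSpace E] (S : Spray E M) (hz : z ∈ slashedDomain E p) {r : ℝ}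
    (hr : 0 < r) : S.vert p (z.1, r • z.2) = r ^ 2 • S.vert p z := by
  have hmem : ∀ s ∈ Ioi (0 : ℝ), (z.1, s • z.2) ∈ slashedDomain E p := fun s hs =>
    ⟨hz.1, smul_ne_zero (ne_of_gt hs) hz.2⟩
  have hd : ∀ s ∈ Ioi (0 : ℝ),
      HasDerivAt (fun s : ℝ => (s ^ 2)⁻¹ • S.vert p (z.1, s • z.2)) 0 s := by
    intro s hs
    have hs0 : s ≠ 0 := ne_of_gt hs
    have hc : HasDerivAt (fun s : ℝ => (z.1, s • z.2)) (0, z.2) s := by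
      refine (hasDerivAt_const _ _).prodMk ?_
      simpa using (hasDerivAt_id s).smul_const z.2
    have h1 := ((S.contDiffAt_vert (hmem s hs)).differentiableAt
      (by simp)).hasFDerivAt.comp_hasDerivAt s hc
    have h2 := S.fderiv_vert (hmem s hs)
    have h3 : ((0 : E), s • z.2) = s • ((0 : E), z.2) := by simp
    rw [h3, map_smul] at h2
    have h4 : fderiv ℝ (S.vert p) (z.1, s • z.2) (0, z.2)
        = (2 * s⁻¹) • S.vert p (z.1, s • z.2) := by
      rw [mul_comm, mul_smul, ← h2, inv_smul_smul₀ hs0]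
    rw [h4] at h1
    have h5 : HasDerivAt (fun s : ℝ => (s ^ 2)⁻¹ • S.vert p (z.1, s • z.2)) _ s :=
      ((hasDerivAt_pow 2 s).inv (pow_ne_zero 2 hs0)).smul h1
    refine h5.congr_deriv ?_
    rw [smul_smul, ← add_smul]
    simp only [Pi.inv_apply]
    have : (s ^ 2)⁻¹ * (2 * s⁻¹) + -(((2 : ℕ) : ℝ) * s ^ (2 - 1)) / (s ^ 2) ^ 2 = 0 := by
      field_simp
      norm_num
      ring
    rw [this, zero_smul]
  have h := isOpen_Ioi.is_const_of_deriv_eq_zero (isPreconnected_Ioi)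
    (fun s hs => (hd s hs).differentiableAt.differentiableWithinAt) (fun s hs => (hd s hs).deriv)
    (mem_Ioi.2 hr) (mem_Ioi.2 one_pos)
  simp only [one_pow, inv_one, one_smul] at h
  have h6 : z = (z.1, z.2) := rfl
  rw [← h6] at h
  rw [← h, smul_inv_smul₀ (pow_ne_zero 2 hr.ne')]

end Spray

end ProjectiveDeformation

/-! ### Solving the equation for the change of parameter. -/

section Reparametrization

theorem exists_contDiffOn_primitive {s : Set ℝ} (hs : IsOpenInterval s) {b : ℝ → ℝ}
    (hb : ContDiffOn ℝ ∞ b s) :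
    ∃ B : ℝ → ℝ, ContDiffOn ℝ ∞ B s ∧ ∀ t ∈ s, HasDerivAt B (b t) t := by
  rcases s.eq_empty_or_nonempty with rfl | ⟨t₀, ht₀⟩
  · exact ⟨0, contDiffOn_empty, fun t ht => ht.elim⟩
  have hd : ∀ t ∈ s, HasDerivAt (fun t => ∫ x in t₀..t, b x) (b t) t := by
    intro t ht
    exact intervalIntegral.integral_hasDerivAt_right
      ((hb.continuousOn.mono (hs.2.uIcc_subset ht₀ ht)).intervalIntegrable)
      (hb.continuousOn.stronglyMeasurableAtFilter hs.1 t ht)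
      (hb.continuousOn.continuousAt (hs.1.mem_nhds ht))
  refine ⟨_, (contDiffOn_infty_iff_deriv_of_isOpen hs.1).2
    ⟨fun t ht => (hd t ht).differentiableAt.differentiableWithinAt, ?_⟩, hd⟩
  exact hb.congr fun t ht => (hd t ht).deriv

/-- A change of parameter `φ` onto the interval `s` that solves `φ'' = - (b ∘ φ) φ' ^ 2`. -/
theorem exists_isReparametrization {s : Set ℝ} (hs : IsOpenInterval s) {b : ℝ → ℝ}
    (hb : ContDiffOn ℝ ∞ b s) :
    ∃ (s' : Set ℝ) (φ ψ : ℝ → ℝ), IsOpenInterval s' ∧ IsReparametrization φ s' s ∧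
      ∀ t ∈ s', HasDerivAt φ (ψ t) t ∧ 0 < ψ t ∧ HasDerivAt ψ (-b (φ t) * ψ t ^ 2) t := by
  -- Two quadratures: `B' = b` and `τ' = exp B`. The inverse `φ` of `τ` satisfies `φ' = exp (-B ∘
  -- φ)`, whose derivative is `-(b ∘ φ) φ'²`.
  obtain ⟨B, hB, hBd⟩ := exists_contDiffOn_primitive hs hb
  obtain ⟨τ, hτ, hτd⟩ := exists_contDiffOn_primitive hs hB.exp
  have hmono : StrictMonoOn τ s := by
    refine strictMonoOn_of_deriv_pos hs.2.convex hτ.continuousOn fun t ht => ?_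
    rw [(hτd t (interior_subset ht)).deriv]
    exact Real.exp_pos _
  have hτat : ∀ t ∈ s, ContDiffAt ℝ ∞ τ t := fun t ht => hτ.contDiffAt (hs.1.mem_nhds ht)
  have hopen : IsOpenMap (s.domRestrict τ) := by
    rw [isOpenMap_iff_nhds_le]
    rintro ⟨t, ht⟩
    have h1 : Filter.map τ (𝓝 t) = 𝓝 (τ t) :=
      ((hτat t ht).hasStrictDerivAt' (hτd t ht) (by simp)).map_nhds_eq (Real.exp_pos _).ne'
    change 𝓝 (τ t) ≤ Filter.map (τ ∘ Subtype.val) (𝓝 (⟨t, ht⟩ : s))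
    rw [← Filter.map_map, map_nhds_subtype_coe_eq_nhds ht (hs.1.mem_nhds ht), h1]
  let e : OpenPartialHomeomorph ℝ ℝ := OpenPartialHomeomorph.ofContinuousOpenRestrict
    (hmono.injOn.toPartialEquiv τ s) hτ.continuousOn hopen hs.1
  have hsrc : e.source = s := rfl
  have htgt : e.target = τ '' s := rfl
  have he : ∀ t, e t = τ t := fun _ => rfl
  have hmaps : ∀ t ∈ e.target, e.symm t ∈ s := fun t ht => e.map_target ht
  have hd : ∀ t ∈ e.target, HasDerivAt e.symm (Real.exp (-B (e.symm t))) t := by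
    intro t ht
    rw [Real.exp_neg]
    exact e.hasDerivAt_symm ht (Real.exp_pos _).ne' (hτd _ (hmaps t ht))
  refine ⟨e.target, e.symm, fun t => Real.exp (-B (e.symm t)), ⟨e.open_target, ?_⟩,
    ⟨?_, ?_, ?_⟩, fun t ht => ⟨hd t ht, Real.exp_pos _, ?_⟩⟩
  · rw [htgt]
    exact (hs.2.isPreconnected.image τ hτ.continuousOn).ordConnected
  · intro t ht
    exact (e.contDiffAt_symm_deriv (Real.exp_pos _).ne' ht (hτd _ (hmaps t ht))
      (hτat _ (hmaps t ht))).contDiffWithinAt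
  · intro t ht
    rw [(hd t ht).deriv]
    exact Real.exp_pos _
  · exact e.symm_image_target_eq_source
  · have h1 := ((hBd _ (hmaps t ht)).comp t (hd t ht)).neg.exp
    refine h1.congr_deriv ?_
    simp only [Function.comp_apply, Pi.neg_apply]
    ring

end Reparametrization

/-! ### Geodesics of projectively deformed sprays. -/

section Geodesics
variable {E : Type*} [NormedAddCommGroup E] [NormedSpace ℝ E]
  {M : Type*} [TopologicalSpace M] [ChartedSpace E M] [IsManifold 𝓘(ℝ, E) ∞ M]
  {p : M} {u : TangentBundle 𝓘(ℝ, E) M} {z : E × E}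

theorem GeodesicsReparametrizeTo.trans {S₁ S₂ S₃ : Spray E M}
    (h₁ : GeodesicsReparametrizeTo S₁ S₂) (h₂ : GeodesicsReparametrizeTo S₂ S₃) :
    GeodesicsReparametrizeTo S₁ S₃ := by
  intro s c hs hc
  obtain ⟨s', φ, hs', hφ, hc'⟩ := h₁ s c hs hc
  obtain ⟨s'', φ', hs'', hφ', hc''⟩ := h₂ s' (c ∘ φ) hs' hc'
  have hmaps : MapsTo φ' s'' s' := fun t ht => hφ'.2.2 ▸ mem_image_of_mem φ' ht
  refine ⟨s'', φ ∘ φ', hs'', ⟨hφ.1.comp hφ'.1 hmaps, fun t ht => ?_, ?_⟩, hc''⟩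
  · have hd : DifferentiableAt ℝ φ (φ' t) :=
      (hφ.1.contDiffAt (hs'.1.mem_nhds (hmaps ht))).differentiableAt (by simp)
    have hd' : DifferentiableAt ℝ φ' t :=
      (hφ'.1.contDiffAt (hs''.1.mem_nhds ht)).differentiableAt (by simp)
    rw [deriv_comp t hd hd']
    exact mul_pos (hφ.2.1 _ (hmaps ht)) (hφ'.2.1 t ht)
  · rw [image_comp, hφ'.2.2, hφ.2.2]

theorem ProjectivelyRelated.trans {S₁ S₂ S₃ : Spray E M} (h₁ : ProjectivelyRelated S₁ S₂)
    (h₂ : ProjectivelyRelated S₂ S₃) : ProjectivelyRelated S₁ S₃ :=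
  ⟨h₁.1.trans h₂.1, h₂.2.trans h₁.2⟩

theorem contMDiffOn_tangentLift {c : ℝ → M} {s : Set ℝ} (hs : IsOpen s)
    (hc : ContMDiffOn 𝓘(ℝ, ℝ) 𝓘(ℝ, E) ∞ c s) :
    ContMDiffOn 𝓘(ℝ, ℝ) 𝓘(ℝ, E).tangent ∞ (tangentLift E c) s := by
  have h1 := hc.contMDiffOn_tangentMapWithin (m := ∞) (by simp) hs.uniqueMDiffOn
  have h2 : ContMDiffOn 𝓘(ℝ, ℝ) 𝓘(ℝ, ℝ).tangent ∞
      (fun t => (⟨t, (1 : ℝ)⟩ : TangentBundle 𝓘(ℝ, ℝ) ℝ)) s :=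
    contMDiffOn_vectorSpace_iff_contDiffOn.2 contDiffOn_const
  refine (h1.comp h2 fun t ht => ht).congr fun t ht => ?_
  rw [Function.comp_apply, tangentMapWithin, mfderivWithin_of_isOpen hs ht]
  rfl

theorem hasDerivAt_tangentChart_comp {γ : ℝ → TangentBundle 𝓘(ℝ, E) M} {t : ℝ}
    {w : TangentSpace 𝓘(ℝ, E).tangent (γ t)} {v : E × E}
    (ht : γ t ∈ (tangentChart E p).source)
    (hγ : HasMFDerivAt 𝓘(ℝ, ℝ) 𝓘(ℝ, E).tangent γ t ((1 : ℝ →L[ℝ] ℝ).smulRight w))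
    (hv : mfderiv 𝓘(ℝ, E).tangent 𝓘(ℝ, E × E) (tangentChart E p) (γ t) w = v) :
    HasDerivAt (tangentChart E p ∘ γ) v t := by
  have h := ((mdifferentiableAt_tangentChart ht).hasMFDerivAt.comp t hγ).hasFDerivAt
  refine hasDerivAt_iff_hasFDerivAt.2 (h.congr_fderiv (ContinuousLinearMap.ext_ring ?_))
  refine Eq.trans ?_ (hv.trans (one_smul ℝ v).symm)
  exact congrArg (mfderiv 𝓘(ℝ, E).tangent 𝓘(ℝ, E × E) (tangentChart E p) (γ t)) (one_smul ℝ w)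

theorem hasMFDerivAt_tangentChart_symm_comp {g : ℝ → E × E} {t : ℝ} {v : E × E}
    (hz : g t ∈ (tangentChart E p).target) (hg : HasDerivAt g v t) :
    HasMFDerivAt 𝓘(ℝ, ℝ) 𝓘(ℝ, E).tangent ((tangentChart E p).symm ∘ g) t
      ((1 : ℝ →L[ℝ] ℝ).smulRight (coordFrame p (g t) v)) := by
  have h1 := (mdifferentiableAt_tangentChart_symm hz).hasMFDerivAt.comp t
    hg.hasFDerivAt.hasMFDerivAt
  refine h1.congr_mfderiv ?_
  ext
  exact map_smul (coordFrame p (g t)) (1 : ℝ) v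

theorem tangentChart_symm_smul {x y : E} (hx : x ∈ (chartAt E p).target) (r : ℝ) :
    (tangentChart E p).symm (x, r • y) = ⟨((tangentChart E p).symm (x, y)).1,
      r • ((tangentChart E p).symm (x, y)).2⟩ := by
  rw [tangentChart_symm_apply (z := (x, r • y)) hx, tangentChart_symm_apply (z := (x, y)) hx]
  refine congrArg (Bundle.TotalSpace.mk ((chartAt E p).symm x)) ?_
  exact map_smul _ r y

theorem tangentLift_comp {c : ℝ → M} {φ : ℝ → ℝ} {t a : ℝ} (hφ : HasDerivAt φ a t)
    (hc : MDifferentiableAt 𝓘(ℝ, ℝ) 𝓘(ℝ, E) c (φ t)) :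
    tangentLift E (c ∘ φ) t = ⟨(tangentLift E c (φ t)).1, a • (tangentLift E c (φ t)).2⟩ := by
  have h := (hc.hasMFDerivAt.comp t hφ.hasFDerivAt.hasMFDerivAt).mfderiv
  have h1 : mfderiv 𝓘(ℝ, ℝ) 𝓘(ℝ, E) (c ∘ φ) t (1 : ℝ)
      = a • mfderiv 𝓘(ℝ, ℝ) 𝓘(ℝ, E) c (φ t) (1 : ℝ) := by
    have h2 : ContinuousLinearMap.toSpanSingleton ℝ a 1 = a • (1 : ℝ) := by simp
    rw [h]
    exact (congrArg (mfderiv 𝓘(ℝ, ℝ) 𝓘(ℝ, E) c (φ t)) h2).trans (map_smul _ a (1 : ℝ))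
  rw [tangentLift, h1]
  rfl

/-- The geodesics of a spray become, after a reparametrization, geodesics of its projective
deformations. -/
theorem IsProjectiveDeformation.geodesicsReparametrizeTo [CompleteSpace E] {S S' : Spray E M}
    {P : TangentBundle 𝓘(ℝ, E) M → ℝ} (h : IsProjectiveDeformation S P S')
    (hP : ContMDiffOn 𝓘(ℝ, E).tangent 𝓘(ℝ, ℝ) ∞ P (slashedTangent E M))
    (hom : IsFiberHomogeneous P) : GeodesicsReparametrizeTo S S' := by
  rintro s c hs ⟨hc, hreg, hgeo⟩
  -- This `b` makes the term `φ''` of the reparametrized curve equal to the correction `-2Pℂ`.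
  have hb : ContDiffOn ℝ ∞ (fun t => 2 * P (tangentLift E c t)) s :=
    contDiffOn_const.mul
      (contMDiffOn_iff_contDiffOn.1 (hP.comp (contMDiffOn_tangentLift hs.1 hc) hreg))
  obtain ⟨s', φ, ψ, hs', hφ, hψ⟩ := exists_isReparametrization hs hb
  have hmaps : MapsTo φ s' s := fun t ht => hφ.2.2 ▸ mem_image_of_mem φ ht
  have hlift : ∀ t ∈ s', tangentLift E (c ∘ φ) t
      = ⟨(tangentLift E c (φ t)).1, ψ t • (tangentLift E c (φ t)).2⟩ := fun t ht =>
    tangentLift_comp (hψ t ht).1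
      ((hc.contMDiffAt (hs.1.mem_nhds (hmaps ht))).mdifferentiableAt (by simp))
  refine ⟨s', φ, hs', hφ, hc.comp hφ.1.contMDiffOn hmaps, ?_, ?_⟩
  · intro t ht
    rw [hlift t ht]
    exact smul_ne_zero (hψ t ht).2.1.ne' (hreg _ (hmaps ht))
  · intro t ht
    set γ := tangentLift E c with hγ
    set p := (γ (φ t)).1 with hp
    have hsrc : γ (φ t) ∈ (tangentChart E p).source :=
      mem_tangentChart_source.2 (mem_chart_source E p)
    set g : ℝ → E × E := tangentChart E p ∘ γ with hg
    have hz : g (φ t) ∈ slashedDomain E p :=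
      tangentChart_mem_slashedDomain (hreg _ (hmaps ht)) hsrc
    have hgd : HasDerivAt g ((g (φ t)).2, S.vert p (g (φ t))) (φ t) := by
      refine hasDerivAt_tangentChart_comp hsrc (hgeo _ (hmaps ht)) ?_
      have h1 : γ (φ t) = (tangentChart E p).symm (g (φ t)) :=
        ((tangentChart E p).left_inv hsrc).symm
      rw [h1, S.toFun_tangentChart_symm hz]
      exact mfderiv_tangentChart_coordFrame (mem_target_of_mem_slashedDomain hz) _
    obtain ⟨hφt, hψt, hψd⟩ := hψ t ht
    -- Near the given parameter, `k` is the tangent lift of `c ∘ φ` in coordinates. Its second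
    -- component has derivative `ψ² H - 2P ψ² y`, which is the deformed `H'` at `k` by homogeneity
    -- of `H` and `P`.
    set k : ℝ → E × E := fun t => ((g (φ t)).1, ψ t • (g (φ t)).2) with hk
    have hgφ := hgd.scomp t hφt
    have hkd : HasDerivAt k (ψ t • (g (φ t)).2, S'.vert p (k t)) t := by
      have hf : HasDerivAt (fun t => (g (φ t)).1) (ψ t • (g (φ t)).2) t :=
        (hasFDerivAt_fst (𝕜 := ℝ) (p := (g ∘ φ) t)).comp_hasDerivAt t hgφ
      have hsn : HasDerivAt (fun t => (g (φ t)).2) (ψ t • S.vert p (g (φ t))) t :=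
        (hasFDerivAt_snd (𝕜 := ℝ) (p := (g ∘ φ) t)).comp_hasDerivAt t hgφ
      refine (hf.prodMk (hψd.smul hsn)).congr_deriv ?_
      have hkz : k t ∈ slashedDomain E p := ⟨hz.1, smul_ne_zero hψt.ne' hz.2⟩
      have hPk : P ((tangentChart E p).symm (k t)) = ψ t * P (γ (φ t)) := by
        rw [hk, hom.coord hz.1 hψt]
        congr 2
        exact (tangentChart E p).left_inv hsrc
      rw [h.vert_eq hkz, hPk]
      simp only [hk]
      rw [S.vert_smul hz hψt]
      refine Prod.ext rfl ?_
      simp only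
      module
    have hkz : k t ∈ (tangentChart E p).target := mem_tangentChart_target.2 hz.1
    have hev : tangentLift E (c ∘ φ) =ᶠ[𝓝 t] (tangentChart E p).symm ∘ k := by
      have hcont : ContinuousAt (γ ∘ φ) t :=
        (hgeo _ (hmaps ht)).continuousAt.comp hφt.continuousAt
      filter_upwards [hs'.1.mem_nhds ht,
        hcont.preimage_mem_nhds (isOpen_tangentChart_source.mem_nhds hsrc)] with σ hσ hσs
      have h2 := tangentChart_symm_smul (y := (g (φ σ)).2)
        (mem_tangentChart_target.1 ((tangentChart E p).map_source hσs)) (ψ σ)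
      have h1 : (tangentChart E p).symm ((g (φ σ)).1, (g (φ σ)).2) = γ (φ σ) :=
        (tangentChart E p).left_inv hσs
      rw [hlift σ hσ]
      refine Eq.trans ?_ h2.symm
      exact congrArg (fun u : TangentBundle 𝓘(ℝ, E) M =>
        (⟨u.1, ψ σ • u.2⟩ : TangentBundle 𝓘(ℝ, E) M)) h1.symm
    have hfin := (hasMFDerivAt_tangentChart_symm_comp hkz hkd).congr_of_eventuallyEq hev
    refine hfin.congr_mfderiv ?_
    have hkS : k t ∈ slashedDomain E p := ⟨hz.1, smul_ne_zero hψt.ne' hz.2⟩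
    have h2 := S'.toFun_tangentChart_symm hkS
    rw [hev.self_of_nhds]
    exact congrArg _ h2.symm

theorem IsProjectiveDeformation.projectivelyRelated [CompleteSpace E] {S S' : Spray E M}
    {P : TangentBundle 𝓘(ℝ, E) M → ℝ} (h : IsProjectiveDeformation S P S')
    (hP : ContMDiffOn 𝓘(ℝ, E).tangent 𝓘(ℝ, ℝ) ∞ P (slashedTangent E M))
    (hom : IsFiberHomogeneous P) : ProjectivelyRelated S S' := by
  refine ⟨h.geodesicsReparametrizeTo hP hom,
    -- Conversely, `S` is the deformation of `S'` by `-P`.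
    IsProjectiveDeformation.geodesicsReparametrizeTo (P := fun u => -P u) ?_ hP.neg ?_⟩
  · intro u hu
    rw [h u hu]
    module
  · intro p y r hr
    simp only [hom p y r hr]
    ring

end Geodesics

/-! ### Infinitely many non-metrizable sprays in a projective class. -/

section Infinitude
variable {E : Type*} [NormedAddCommGroup E] [NormedSpace ℝ E]
  {M : Type*} [TopologicalSpace M] [ChartedSpace E M] [IsManifold 𝓘(ℝ, E) ∞ M]
  {u : TangentBundle 𝓘(ℝ, E) M}

theorem liouville_ne_zero (hu : u ∈ slashedTangent E M) : liouville u ≠ 0 := by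
  have hs : u ∈ (tangentChart E u.1).source := mem_tangentChart_source.2 (mem_chart_source E u.1)
  have hz := tangentChart_mem_slashedDomain hu hs
  have ht := mem_target_of_mem_slashedDomain hz
  rw [← (tangentChart E u.1).left_inv hs, liouville_tangentChart_symm ht]
  intro h
  have h1 := (coordFrame_isInvertible ht).injective (h.trans (map_zero _).symm)
  exact hz.2 (congrArg Prod.snd h1)

/-- Since `ℂ` vanishes nowhere off the zero section, the spray determines the factor; distinct
multiples of a function that is nonzero somewhere there give distinct sprays. -/
theorem IsProjectiveDeformation.factor_eq {S S' : Spray E M}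
    {P Q : TangentBundle 𝓘(ℝ, E) M → ℝ} (hP : IsProjectiveDeformation S P S')
    (hQ : IsProjectiveDeformation S Q S') (hu : u ∈ slashedTangent E M) : P u = Q u := by
  have h := sub_right_injective ((hP u hu).symm.trans (hQ u hu))
  have h1 := smul_left_injective ℝ (liouville_ne_zero hu) h
  linarith

omit [IsManifold 𝓘(ℝ, E) ∞ M] in
theorem IsFiberHomogeneous.const_mul {P : TangentBundle 𝓘(ℝ, E) M → ℝ}
    (hP : IsFiberHomogeneous P) (r : ℝ) : IsFiberHomogeneous fun u => r * P u := by
  intro p y s hs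
  simp only [hP p y s hs]
  ring

/-- There is a smooth nonzero fibrewise linear function on the tangent bundle: the differential of
a compactly supported function. -/
theorem exists_contMDiff_isFiberHomogeneous [FiniteDimensional ℝ E] [Nontrivial E] [T2Space M]
    [Nonempty M] : ∃ P : TangentBundle 𝓘(ℝ, E) M → ℝ,
      ContMDiff 𝓘(ℝ, E).tangent 𝓘(ℝ, ℝ) ∞ P ∧ IsFiberHomogeneous P ∧
        ∃ u ∈ slashedTangent E M, P u ≠ 0 := by
  obtain ⟨p⟩ := ‹Nonempty M›
  obtain ⟨v, hv⟩ := exists_ne (0 : E)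
  obtain ⟨l, hl⟩ := SeparatingDual.exists_ne_zero (R := ℝ) hv
  obtain ⟨f⟩ : Nonempty (SmoothBumpFunction 𝓘(ℝ, E) p) := inferInstance
  -- A linear coordinate, cut off by a bump function equal to `1` near `p`; its differential at `p`
  -- is `l`, so it is nonzero on `v`.
  set g : M → ℝ := fun x => f x • l (extChartAt 𝓘(ℝ, E) p x) with hg
  have hgs : ContMDiff 𝓘(ℝ, E) 𝓘(ℝ, ℝ) ∞ g :=
    f.contMDiff_smul (g := fun x => l (extChartAt 𝓘(ℝ, E) p x))
      (l.contMDiff.comp_contMDiffOn contMDiffOn_extChartAt)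
  refine ⟨fun u => mfderiv 𝓘(ℝ, E) 𝓘(ℝ, ℝ) g u.1 u.2,
    (contMDiff_snd_tangentBundle_modelSpace ℝ 𝓘(ℝ, ℝ)).comp
      (hgs.contMDiff_tangentMap (m := ∞) (by simp)), fun q y r _ => ?_, ⟨p, v⟩, hv, ?_⟩
  · exact map_smul (mfderiv 𝓘(ℝ, E) 𝓘(ℝ, ℝ) g q) r y
  · have h1 : g =ᶠ[𝓝 p] l ∘ extChartAt 𝓘(ℝ, E) p := by
      filter_upwards [f.eventuallyEq_one] with x hx
      simp [hg, hx]
    have h2 : HasMFDerivAt 𝓘(ℝ, E) 𝓘(ℝ, ℝ) (l ∘ extChartAt 𝓘(ℝ, E) p) p _ :=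
      l.hasMFDerivAt.comp p
        (mdifferentiableAt_extChartAt (mem_chart_source E p)).hasMFDerivAt
    have h3 : mfderiv 𝓘(ℝ, E) 𝓘(ℝ, ℝ) g p v = l v := by
      rw [h1.mfderiv_eq, h2.mfderiv, mfderiv_extChartAt_self]
      rfl
    exact h3.trans_ne hl

theorem infinite_not_isFinslerMetrizable_deformation [FiniteDimensional ℝ E] [Nonempty M]
    (hE : 1 < Module.finrank ℝ E) {S S₀ : Spray E M} {F : TangentBundle 𝓘(ℝ, E) M → ℝ}
    (hF : IsFinslerFunction F) (hS₀ : IsGeodesicSpray F S₀) (hrel : S₀ ∈ projectiveClass S) :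
    {r : ℝ | ∃ S' : Spray E M, IsProjectiveDeformation S₀ (fun u => r * F u) S' ∧
      S' ∈ projectiveClass S ∧ ¬ IsFinslerMetrizable S'}.Infinite := by
  have : CompleteSpace E := FiniteDimensional.complete ℝ E
  have : Nontrivial E := Module.nontrivial_of_finrank_pos (R := ℝ) (zero_lt_one.trans hE)
  obtain ⟨p⟩ := ‹Nonempty M›
  obtain ⟨y, hy⟩ := exists_ne (0 : E)
  refine (infinite_isUnit_add_sq_smul_one (jacobiEndomorphism (S₀.vert p) (chartAt E p p, y))
    (hF.pos ⟨p, y⟩ hy)).mono ?_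
  rintro r ⟨hr, hunit⟩
  have hsm : ContMDiffOn 𝓘(ℝ, E).tangent 𝓘(ℝ, ℝ) ∞ (fun u => r * F u) (slashedTangent E M) :=
    contMDiffOn_const.mul hF.smooth
  have hom : IsFiberHomogeneous fun u => r * F u :=
    IsFiberHomogeneous.const_mul hF.homogeneous r
  obtain ⟨S', hS'⟩ := exists_isProjectiveDeformation S₀ hsm hom
  exact ⟨S', hS', ProjectivelyRelated.trans hrel (hS'.projectivelyRelated hsm hom),
    not_isFinslerMetrizable_of_isUnit hE hF hS₀ hr hS' hy hunit⟩

end Infinitude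

theorem mainTheorem2
    {E : Type*} [NormedAddCommGroup E] [NormedSpace ℝ E] [FiniteDimensional ℝ E]
    (hE : 1 < Module.finrank ℝ E)
    {M : Type*} [TopologicalSpace M] [T2Space M] [Nonempty M]
    [ChartedSpace E M] [IsManifold 𝓘(ℝ, E) ∞ M]
    (S : Spray E M) :
    {S' ∈ projectiveClass S | ¬ IsFinslerMetrizable S'}.Infinite ∧
    ∀ (F : TangentBundle 𝓘(ℝ, E) M → ℝ) (S₀ : Spray E M),
      IsFinslerFunction F → IsGeodesicSpray F S₀ → S₀ ∈ projectiveClass S →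
      {r : ℝ | ∃ S' : Spray E M, IsProjectiveDeformation S₀ (fun u => r * F u) S' ∧
        S' ∈ projectiveClass S ∧ ¬ IsFinslerMetrizable S'}.Infinite := by
  have : CompleteSpace E := FiniteDimensional.complete ℝ E
  have : Nontrivial E := Module.nontrivial_of_finrank_pos (R := ℝ) (zero_lt_one.trans hE)
  refine ⟨?_, fun F S₀ hF hS₀ hrel => infinite_not_isFinslerMetrizable_deformation hE hF hS₀ hrel⟩
  by_cases hex : ∃ S₀ ∈ projectiveClass S, IsFinslerMetrizable S₀
  · obtain ⟨S₀, hrel, F, hF, hS₀⟩ := hex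
    have hinf := infinite_not_isFinslerMetrizable_deformation hE hF hS₀ hrel
    have : Nonempty (Spray E M) := ⟨S⟩
    choose! f hf using fun (r : ℝ) (hr : r ∈ {r : ℝ | ∃ S' : Spray E M,
      IsProjectiveDeformation S₀ (fun u => r * F u) S' ∧
        S' ∈ projectiveClass S ∧ ¬ IsFinslerMetrizable S'}) => hr
    refine infinite_of_injOn_mapsTo (f := f) (fun r hr s hs hrs => ?_) (fun r hr => (hf r hr).2)
      hinf
    obtain ⟨p⟩ := ‹Nonempty M›
    obtain ⟨y, hy⟩ := exists_ne (0 : E)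
    have h1 := (hf r hr).1
    rw [hrs] at h1
    exact mul_right_cancel₀ (hF.pos ⟨p, y⟩ hy).ne' (h1.factor_eq (hf s hs).1 hy)
  -- No member of the class is metrizable here, so it is enough that the class is infinite.
  · push Not at hex
    obtain ⟨P, hP, hom, u, hu, hPu⟩ := exists_contMDiff_isFiberHomogeneous (E := E) (M := M)
    have hsm : ∀ r : ℝ,
        ContMDiffOn 𝓘(ℝ, E).tangent 𝓘(ℝ, ℝ) ∞ (fun u => r * P u) (slashedTangent E M) :=
      fun r => contMDiffOn_const.mul hP.contMDiffOn
    choose f hf using fun r : ℝ => exists_isProjectiveDeformation S (hsm r) (hom.const_mul r)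
    have hmem : ∀ r, f r ∈ projectiveClass S := fun r =>
      (hf r).projectivelyRelated (hsm r) (hom.const_mul r)
    refine infinite_of_injective_forall_mem (f := f) (fun r s hrs => ?_)
      fun r => ⟨hmem r, hex _ (hmem r)⟩
    have h1 := hf r
    rw [hrs] at h1
    exact mul_right_cancel₀ hPu (h1.factor_eq (hf s) hu)
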